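/- **Definitions.** For $k,n\ge 1$ let $\mathcal L_k^{(n)}$ be the unitary on $kn+1$ qubits which maps the computational basis state $|x_0,\dots,x_{kn}\rangle$ to the basis state in which $x_{ki}$ is replaced by $x_{ki}\oplus x_{ki-1}x_{ki-2}\cdots x_{ki-k}$ for every $1\le i\le n$ (products taken of the original bits) and all other bits are unchanged; $\mathcal L_k^{(0)}$ is the identity on one qubit. Put $\mathcal V_k^{(n)}=\mathcal L_k^{(n)}\bigl({\mathcal L_k^{(n-1)}}^{\dagger}\otimes I\bigr)$, where $I$ acts on the last $k$ qubits. A *strong promise gate* with target unitary $U$ is an operator $\hat U=\sum_{j}|j\rangle\langle j|\otimes U_j$ on a promise register and a target register, where $j$ runs over all bit strings of the promise register, every $U_j$ is a unitary on the target register, and $U_{0\cdots 0}=U$. A *controlled strong promise gate* is $|0\rangle\langle 0|\otimes I+|1\rangle\langle 1|\otimes\hat U$, with one additional control qubit, for some such $\hat U$. A circuit over $\{CCX,CX,X\}$ is a sequence of layers, each consisting of Toffoli, CNOT and NOT gates acting on pairwise disjoint sets of qubits; its gate count is the total number of gates and its depth is the number of layers. **Statement.** For every $n\ge 1$, some controlled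 strong promise gate with target unitary $\mathcal V_2^{(n)}$ and a promise register of $2\lceil\sqrt n\rceil$ qubits can be implemented exactly by a circuit over $\{CCX,CX,X\}$ acting only on the $1+2\lceil\sqrt n\rceil+(2n+1)$ qubits of the control, promise and target registers (no ancilla qubits), with $O(n)$ gates and $O(\log n)$ depth. That is, there is a constant $C>0$ such that for all $n\ge1$ such a circuit exists with at most $Cn$ gates and, if $n\ge2$, with depth at most $C\log n$. -/

import Mathlib

open scoped Kronecker

namespace PromiseGate

/-- Operators on a finite register of qubits labelled by `q`, as complex matrices in the
computational basis; the basis state `|x⟩` is given by the bit string `x : q → Bool`. -/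
abbrev QOp (q : Type) : Type := Matrix (q → Bool) (q → Bool) ℂ

/-- The linear operator `|x⟩ ↦ |f x⟩`. -/
def basisOp {q : Type} [Fintype q] [DecidableEq q] (f : (q → Bool) → (q → Bool)) : QOp q :=
  Matrix.of fun y x => if y = f x then 1 else 0

/-- The tensor product of operators on two registers, acting on the joint register. -/
def tensor {a b : Type} (A : QOp a) (B : QOp b) : QOp (a ⊕ b) :=
  (A ⊗ₖ B).submatrix (Equiv.sumArrowEquivProdArrow a b Bool)
    (Equiv.sumArrowEquivProdArrow a b Bool)

/-- Renaming of the qubits of a register. -/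
def relabel {a b : Type} (e : a ≃ b) (A : QOp a) : QOp b :=
  A.submatrix (fun y => y ∘ e) (fun x => x ∘ e)

/-- The projector `|j⟩⟨j|`. -/
def proj {q : Type} [Fintype q] [DecidableEq q] (j : q → Bool) : QOp q :=
  Matrix.single j j 1

/-! ### Circuits over the gate set `{CCX, CX, X}` -/

/-- A gate from `{CCX, CX, X}` applied to pairwise distinct qubits of the register `q`
(controls first, target last). -/
inductive Gate (q : Type) : Type
  | X (t : q) : Gate q
  | CX (c t : q) (h : c ≠ t) : Gate q
  | CCX (c₁ c₂ t : q) (h₁₂ : c₁ ≠ c₂) (h₁ : c₁ ≠ t) (h₂ : c₂ ≠ t) : Gate q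

namespace Gate

variable {q : Type} [DecidableEq q]

/-- The action of a gate on bit strings: the target is flipped iff all controls are `1`. -/
def act : Gate q → (q → Bool) → (q → Bool)
  | X t, x => Function.update x t (xor (x t) true)
  | CX c t _, x => Function.update x t (xor (x t) (x c))
  | CCX c₁ c₂ t _ _ _, x => Function.update x t (xor (x t) (x c₁ && x c₂))

/-- The unitary of a gate, acting as the identity on the qubits it does not touch. -/
def op [Fintype q] (g : Gate q) : QOp q := basisOp g.act

/-- The qubits touched by a gate. -/
def qubits : Gate q → Finset q
  | X t => {t}
  | CX c t _ => {c, t}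
  | CCX c₁ c₂ t _ _ _ => {c₁, c₂, t}

end Gate

/-- A circuit without ancilla qubits on the register `q`: a sequence of layers, in order of
time, where the gates within one layer act on pairwise disjoint sets of qubits. -/
structure Circuit (q : Type) [DecidableEq q] where
  layers : List (List (Gate q))
  disjoint : ∀ l ∈ layers, l.Pairwise fun g g' => Disjoint g.qubits g'.qubits

namespace Circuit

variable {q : Type} [DecidableEq q]

/-- The number of gates. -/
def gateCount (c : Circuit q) : ℕ := c.layers.flatten.length

/-- The number of layers. -/
def depth (c : Circuit q) : ℕ := c.layers.length

/-- The unitary implemented by a circuit: the product of its gates, the earliest gate being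
the rightmost factor. -/
def op [Fintype q] (c : Circuit q) : QOp q :=
  c.layers.flatten.foldl (fun M g => g.op * M) 1

end Circuit

/-! ### The ladder operators -/

/-- The map on bit strings `x = (x₀, …, x_{kn})` that replaces `x_{ki}` by
`x_{ki} ⊕ x_{ki-1} ⋯ x_{ki-k}` for `1 ≤ i ≤ n` and keeps the other bits. -/
def ladderMap (k n : ℕ) (x : Fin (k * n + 1) → Bool) : Fin (k * n + 1) → Bool := fun i =>
  if 0 < (i : ℕ) ∧ k ∣ (i : ℕ) then
    xor (x i) (decide (∀ l : Fin k, x ⟨(i : ℕ) - (l + 1), by omega⟩ = true))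
  else x i

/-- The operator `𝓛_k^{(n)}` on `kn + 1` qubits. -/
def ladderOp (k n : ℕ) : QOp (Fin (k * n + 1)) := basisOp (ladderMap k n)

/-- The first `km + 1` qubits followed by the last `k` qubits, as a register of
`k(m + 1) + 1` qubits. -/
def splitEquiv (k m : ℕ) : Fin (k * m + 1) ⊕ Fin k ≃ Fin (k * (m + 1) + 1) :=
  finSumFinEquiv.trans (finCongr (by ring))

/-- The operator `𝓥_k^{(n)} = 𝓛_k^{(n)} (𝓛_k^{(n-1)}† ⊗ I)` on `kn + 1` qubits, for `n ≥ 1`.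
(The value at `n = 0` is a placeholder.) -/
def vOp (k : ℕ) : (n : ℕ) → QOp (Fin (k * n + 1))
  | 0 => 1
  | m + 1 => ladderOp k (m + 1) *
      relabel (splitEquiv k m) (tensor (ladderOp k m).conjTranspose (1 : QOp (Fin k)))

/-! ### Promise gates -/

/-- `S` is a strong promise gate with promise register `p`, target register `t` and target
unitary `U`: `S = ∑ j, |j⟩⟨j| ⊗ W j` with all `W j` unitary and `W 0 = U`. -/
def IsStrongPromiseGate {p t : Type} [Fintype p] [DecidableEq p] [Fintype t] [DecidableEq t]
    (U : QOp t) (S : QOp (p ⊕ t)) : Prop :=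
  ∃ W : (p → Bool) → QOp t,
    (∀ j, W j ∈ Matrix.unitaryGroup (t → Bool) ℂ) ∧
    W (fun _ => false) = U ∧
    S = ∑ j : p → Bool, tensor (proj j) (W j)

/-- The singly controlled version `|0⟩⟨0| ⊗ I + |1⟩⟨1| ⊗ G` of `G`; the control qubit is the
left summand. -/
def controlled {q : Type} [Fintype q] [DecidableEq q] (G : QOp q) : QOp (Unit ⊕ q) :=
  tensor (proj fun _ => false) 1 + tensor (proj fun _ => true) G

/-- `T` is a controlled strong promise gate with target unitary `U`. -/
def IsControlledStrongPromiseGate {p t : Type} [Fintype p] [DecidableEq p] [Fintype t]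
    [DecidableEq t] (U : QOp t) (T : QOp (Unit ⊕ (p ⊕ t))) : Prop :=
  ∃ S : QOp (p ⊕ t), IsStrongPromiseGate U S ∧ T = controlled S

end PromiseGate

namespace PromiseGate

/-! ### Gates as reversible maps on bit strings. -/

section Gates

variable {q : Type} [DecidableEq q]

/-! With `h₀ = x₀` and `hᵢ = x₂ᵢ ⊕ x₂ᵢ₋₁ hᵢ₋₁`, the operator `𝓥₂⁽ⁿ⁾` flips the last bit by `x₂ₙ₋₁
hₙ₋₁` and changes nothing else (`vOp_two_succ`). The task is thus to evaluate a composition of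
affine maps `c ↦ g ⊕ p c` over `𝔽₂` at `x₀`, with few work qubits and in logarithmic depth.

Composition is associative, so a binary tree evaluates it: merging `(g, p)` with `(g', p')` gives
`(g ⊕ p g', p p')`. The constant part overwrites `g`, but each product of slopes needs a clean
qubit, and only logarithmically many are supplied. The remedy is conditional cleanliness. After each
merge both used slopes are negated. If the total slope of the tree is `1`, every slope below it was
`1`, so all these qubits are now `0` and can serve as work qubits. If the total slope is `0`, the
rest of the composition has no influence, so it may be computed wrongly (`BTree.exists_gates`).

The entries are therefore cut into blocks. The slope qubits of one block, with the root replaced by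
a single fresh qubit, form the work tree for a block twice as long. Hence about `log₂ n` promise
qubits suffice (`exists_gates_evalEntries`). Slopes low in the tree are released early, so the next
block starts a constant time after the current one. This overlap gives depth `O(log n)` instead of
`O(log² n)`; it is tracked by availability times, which `exists_layers` turns into genuine layers.

Finally, the computed bit is multiplied by `x₂ₙ₋₁` into one more promise qubit, copied to the last
qubit under the control, and everything is uncomputed. Only the copying gate is controlled. Since
the computation touches neither the control nor the last qubit, every promise string yields a
permutation of the target register, even where the work qubits were not clean. -/

theorem Gate.qubits_nonempty (g : Gate q) : g.qubits.Nonempty := by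
  cases g <;> simp [Gate.qubits]

theorem Gate.act_apply_of_notMem (g : Gate q) (x : q → Bool) {i : q} (hi : i ∉ g.qubits) :
    g.act x i = x i := by
  cases g <;> simp_all [Gate.qubits, Gate.act]

theorem Gate.act_congr (g : Gate q) {x y : q → Bool} (h : ∀ i ∈ g.qubits, x i = y i) {i : q}
    (hi : i ∈ g.qubits) : g.act x i = g.act y i := by
  have hi' := h i hi
  cases g <;> simp_all [Gate.qubits, Gate.act, Function.update_apply]

theorem Gate.act_act (g : Gate q) (x : q → Bool) : g.act (g.act x) = x := by
  cases g with
  | X t => simp [Gate.act]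
  | CX c t h => simp [Gate.act, Function.update_of_ne h]
  | CCX c₁ c₂ t h₁₂ h₁ h₂ =>
    simp [Gate.act, Function.update_of_ne h₁, Function.update_of_ne h₂]

/-- A gate reads and writes only its own qubits. -/
theorem Gate.act_comm {g g' : Gate q} (h : Disjoint g.qubits g'.qubits) (x : q → Bool) :
    g.act (g'.act x) = g'.act (g.act x) := by
  rw [Finset.disjoint_left] at h
  ext i
  by_cases hi : i ∈ g.qubits
  · rw [g'.act_apply_of_notMem _ (h hi)]
    exact g.act_congr (fun j hj => g'.act_apply_of_notMem _ (h hj)) hi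
  · rw [g.act_apply_of_notMem _ hi]
    by_cases hi' : i ∈ g'.qubits
    · exact g'.act_congr (fun j hj => (g.act_apply_of_notMem _ fun hj' => h hj' hj).symm) hi'
    · rw [g'.act_apply_of_notMem _ hi', g'.act_apply_of_notMem _ hi', g.act_apply_of_notMem _ hi]

/-- The action of a sequence of gates on bit strings. -/
def runGates (gs : List (Gate q)) (x : q → Bool) : q → Bool :=
  gs.foldl (fun x g => g.act x) x

@[simp] theorem runGates_nil (x : q → Bool) : runGates [] x = x := rfl

@[simp] theorem runGates_cons (g : Gate q) (gs : List (Gate q)) (x : q → Bool) :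
    runGates (g :: gs) x = runGates gs (g.act x) := rfl

theorem runGates_append (gs gs' : List (Gate q)) (x : q → Bool) :
    runGates (gs ++ gs') x = runGates gs' (runGates gs x) := List.foldl_append

theorem runGates_reverse (gs : List (Gate q)) (x : q → Bool) :
    runGates gs.reverse (runGates gs x) = x := by
  induction gs generalizing x with
  | nil => rfl
  | cons g gs ih => simp [runGates_append, ih, Gate.act_act]

theorem runGates_apply_of_notMem {gs : List (Gate q)} {i : q} (h : ∀ g ∈ gs, i ∉ g.qubits)
    (x : q → Bool) : runGates gs x i = x i := by
  induction gs generalizing x with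
  | nil => rfl
  | cons g gs ih =>
    rw [runGates_cons, ih (fun g' hg' => h g' (by simp [hg'])),
      g.act_apply_of_notMem _ (h g (by simp))]

theorem runGates_congr {gs : List (Gate q)} {s : Set q} (h : ∀ g ∈ gs, ∀ i ∈ g.qubits, i ∈ s)
    {x y : q → Bool} (hxy : ∀ i ∈ s, x i = y i) {i : q} (hi : i ∈ s) :
    runGates gs x i = runGates gs y i := by
  induction gs generalizing x y with
  | nil => exact hxy i hi
  | cons g gs ih =>
    refine ih (fun g' hg' => h g' (by simp [hg'])) fun j hj => ?_
    change g.act x j = g.act y j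
    by_cases hjg : j ∈ g.qubits
    · exact g.act_congr (fun k hk => hxy k (h g (by simp) k hk)) hjg
    · rw [g.act_apply_of_notMem _ hjg, g.act_apply_of_notMem _ hjg, hxy j hj]

theorem runGates_act_comm {g : Gate q} {gs : List (Gate q)}
    (h : ∀ g' ∈ gs, Disjoint g.qubits g'.qubits) (x : q → Bool) :
    runGates gs (g.act x) = g.act (runGates gs x) := by
  induction gs generalizing x with
  | nil => rfl
  | cons g' gs ih =>
    rw [runGates_cons, runGates_cons, ← Gate.act_comm (h g' (by simp)),
      ih fun g'' hg'' => h g'' (by simp [hg''])]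

/-! ### Scheduling: from availability times to layers. -/

/-- If `τ i` is the time at which the qubit `i` becomes available, then `g.time τ i` is the time
at which it is available after the gate `g` has been applied as soon as possible. -/
def Gate.time (g : Gate q) (τ : q → ℕ) : q → ℕ := fun i =>
  if i ∈ g.qubits then g.qubits.sup τ + 1 else τ i

/-- The times at which the qubits are available after an as-soon-as-possible execution. -/
def runTime (gs : List (Gate q)) (τ : q → ℕ) : q → ℕ :=
  gs.foldl (fun τ g => g.time τ) τ

@[simp] theorem runTime_nil (τ : q → ℕ) : runTime [] τ = τ := rfl

@[simp] theorem runTime_cons (g : Gate q) (gs : List (Gate q)) (τ : q → ℕ) :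
    runTime (g :: gs) τ = runTime gs (g.time τ) := rfl

theorem runTime_append (gs gs' : List (Gate q)) (τ : q → ℕ) :
    runTime (gs ++ gs') τ = runTime gs' (runTime gs τ) := List.foldl_append

theorem runTime_apply_of_notMem {gs : List (Gate q)} {i : q} (h : ∀ g ∈ gs, i ∉ g.qubits)
    (τ : q → ℕ) : runTime gs τ i = τ i := by
  induction gs generalizing τ with
  | nil => rfl
  | cons g gs ih =>
    rw [runTime_cons, ih (fun g' hg' => h g' (by simp [hg'])), Gate.time,
      if_neg (h g (by simp))]

theorem Gate.le_time (g : Gate q) (τ : q → ℕ) (i : q) : τ i ≤ g.time τ i := by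
  unfold Gate.time
  split_ifs with h
  · exact (Finset.le_sup h).trans (Nat.le_succ _)
  · exact le_rfl

theorem Gate.time_le {g : Gate q} {τ : q → ℕ} {B : ℕ} (h : ∀ i ∈ g.qubits, τ i + 1 ≤ B) (i : q) :
    g.time τ i ≤ max (τ i) B := by
  unfold Gate.time
  split_ifs with hi
  · refine le_max_of_le_right ?_
    obtain ⟨j, hj, hj'⟩ := Finset.exists_mem_eq_sup _ g.qubits_nonempty τ
    rw [hj']
    exact h j hj
  · exact le_max_left _ _

/-- As-soon-as-possible scheduling: the gates can be arranged in layers. -/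
theorem exists_layers (gs : List (Gate q)) (D : ℕ) (hD : ∀ i, runTime gs 0 i ≤ D) :
    ∃ L : ℕ → List (Gate q),
      (∀ k, (L k).Pairwise fun g g' => Disjoint g.qubits g'.qubits) ∧
      (∀ k, ∀ g ∈ L k, ∀ i ∈ g.qubits, k < runTime gs 0 i) ∧
      ((List.range D).flatMap L).Perm gs ∧
      ∀ x, runGates ((List.range D).flatMap L) x = runGates gs x := by
  induction gs using List.reverseRecOn with
  | nil =>
    have h : (List.range D).flatMap (fun _ => ([] : List (Gate q))) = [] := by simp
    exact ⟨fun _ => [], by simp, by simp, by rw [h], by simp [h]⟩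
  | append_singleton gs g ih =>
    set τ := runTime gs 0 with hτ
    have hτ' : runTime (gs ++ [g]) 0 = g.time τ := by rw [runTime_append]; rfl
    rw [hτ'] at hD ⊢
    obtain ⟨L, hdisj, htime, hperm, hrun⟩ := ih fun i => (g.le_time τ i).trans (hD i)
    -- The first layer in which all qubits of the new gate are free.
    set k := g.qubits.sup τ with hk
    have hkD : k < D := by
      obtain ⟨j, hj⟩ := g.qubits_nonempty
      have := hD j
      rw [Gate.time, if_pos hj] at this
      exact this
    -- A gate in layer `k'` keeps its qubits busy beyond time `k'`, whereas those of `g` are free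
    -- from time `k` on. So `g` can be moved back from the end into layer `k`.
    have hcomm : ∀ k', k ≤ k' → ∀ g' ∈ L k', Disjoint g.qubits g'.qubits := by
      intro k' hk' g' hg'
      rw [Finset.disjoint_left]
      intro i hi hi'
      have h1 := htime k' g' hg' i hi'
      have h2 : τ i ≤ k := Finset.le_sup hi
      omega
    obtain ⟨e, rfl⟩ : ∃ e, D = k + 1 + e := ⟨D - (k + 1), by omega⟩
    have hsplit : ∀ M : ℕ → List (Gate q), (List.range (k + 1 + e)).flatMap M =
        (List.range k).flatMap M ++ M k ++ (List.range e).flatMap fun j => M (k + 1 + j) := by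
      intro M
      simp [List.range_add, List.range_succ, List.flatMap_append, List.flatMap_map]
    set L' := Function.update L k (L k ++ [g]) with hL'
    have e1 : (List.range k).flatMap L' = (List.range k).flatMap L := by
      refine List.flatMap_congr fun j hj => ?_
      rw [hL', Function.update_of_ne]
      exact (List.mem_range.1 hj).ne
    have e2 : ((List.range e).flatMap fun j => L' (k + 1 + j)) =
        (List.range e).flatMap fun j => L (k + 1 + j) := by
      refine List.flatMap_congr fun j hj => ?_
      rw [hL', Function.update_of_ne]
      omega
    have e3 : L' k = L k ++ [g] := Function.update_self ..
    rw [hsplit] at hrun hperm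
    refine ⟨L', fun k' => ?_, fun k' g' hg' i hi => ?_, ?_, fun x => ?_⟩
    · by_cases h : k' = k
      · subst h
        rw [e3, List.pairwise_append]
        refine ⟨hdisj _, by simp, fun a ha b hb => ?_⟩
        rw [List.mem_singleton.1 hb]
        exact (hcomm _ le_rfl a ha).symm
      · rw [hL', Function.update_of_ne h]
        exact hdisj k'
    · by_cases h : k' = k
      · subst h
        rw [e3, List.mem_append, List.mem_singleton] at hg'
        rcases hg' with hg' | rfl
        · exact (htime _ g' hg' i hi).trans_le (g.le_time τ i)
        · rw [Gate.time, if_pos hi]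
          omega
      · rw [hL', Function.update_of_ne h] at hg'
        exact (htime _ g' hg' i hi).trans_le (g.le_time τ i)
    · rw [hsplit, e1, e2, e3]
      refine List.Perm.trans ?_ (hperm.append_right [g])
      simp only [List.append_assoc]
      exact List.Perm.append_left _ (List.Perm.append_left _ List.perm_append_comm)
    · rw [hsplit, e1, e2, e3, runGates_append _ [g], ← hrun]
      simp only [runGates_append, runGates_cons, runGates_nil]
      refine runGates_act_comm (fun g' hg' => ?_) _
      obtain ⟨j, -, hj⟩ := List.mem_flatMap.1 hg'
      exact hcomm _ (by omega) g' hj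

theorem exists_circuit (gs : List (Gate q)) (D : ℕ) (hD : ∀ i, runTime gs 0 i ≤ D) :
    ∃ c : Circuit q, c.depth = D ∧ c.layers.flatten.Perm gs ∧
      ∀ x, runGates c.layers.flatten x = runGates gs x := by
  obtain ⟨L, hdisj, -, hperm, hrun⟩ := exists_layers gs D hD
  refine ⟨⟨(List.range D).map L, ?_⟩, ?_, ?_, ?_⟩
  · intro l hl
    obtain ⟨k, -, rfl⟩ := List.mem_map.1 hl
    exact hdisj k
  · simp [Circuit.depth]
  · simpa [List.flatMap_def] using hperm
  · simpa [List.flatMap_def] using hrun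

/-- The circuit that applies `c`, then the gate `g`, and then undoes `c`. -/
def Circuit.conj (c : Circuit q) (g : Gate q) : Circuit q where
  layers := c.layers ++ [[g]] ++ (c.layers.map List.reverse).reverse
  disjoint := by
    intro l hl
    simp only [List.mem_append, List.mem_singleton, List.mem_reverse, List.mem_map] at hl
    rcases hl with (hl | rfl) | ⟨l, hl, rfl⟩
    · exact c.disjoint l hl
    · simp
    · rw [List.pairwise_reverse]
      exact (c.disjoint l hl).imp fun h => h.symm

theorem Circuit.depth_conj (c : Circuit q) (g : Gate q) : (c.conj g).depth = 2 * c.depth + 1 := by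
  simp [Circuit.conj, Circuit.depth]
  omega

theorem Circuit.flatten_conj (c : Circuit q) (g : Gate q) :
    (c.conj g).layers.flatten = c.layers.flatten ++ [g] ++ c.layers.flatten.reverse := by
  simp [Circuit.conj, List.reverse_flatten]

theorem Circuit.gateCount_conj (c : Circuit q) (g : Gate q) :
    (c.conj g).gateCount = 2 * c.gateCount + 1 := by
  rw [Circuit.gateCount, Circuit.flatten_conj, Circuit.gateCount]
  simp only [List.length_append, List.length_reverse, List.length_singleton]
  omega

end Gates

/-! ### Operators that permute the computational basis. -/

section Operators

theorem basisOp_apply {q : Type} [Fintype q] [DecidableEq q] (f : (q → Bool) → (q → Bool))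
    (y x : q → Bool) : basisOp f y x = if y = f x then 1 else 0 := rfl

theorem basisOp_id {q : Type} [Fintype q] [DecidableEq q] : (basisOp id : QOp q) = 1 := by
  ext y x
  simp [basisOp_apply, Matrix.one_apply]

theorem basisOp_mul {q : Type} [Fintype q] [DecidableEq q] (f g : (q → Bool) → (q → Bool)) :
    basisOp f * basisOp g = basisOp (f ∘ g) := by
  ext y x
  simp [basisOp_apply, Matrix.mul_apply]

theorem basisOp_mem_unitaryGroup {q : Type} [Fintype q] [DecidableEq q]
    {f : (q → Bool) → (q → Bool)} (hf : Function.Injective f) :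
    basisOp f ∈ Matrix.unitaryGroup (q → Bool) ℂ := by
  rw [Matrix.mem_unitaryGroup_iff']
  ext y x
  simp [basisOp_apply, Matrix.mul_apply, Matrix.star_apply, Matrix.one_apply, hf.eq_iff,
    eq_comm]

theorem foldl_op_eq_basisOp {q : Type} [Fintype q] [DecidableEq q] (gs : List (Gate q))
    (f : (q → Bool) → (q → Bool)) :
    gs.foldl (fun M g => g.op * M) (basisOp f) =
      basisOp fun x => gs.foldl (fun x g => g.act x) (f x) := by
  induction gs generalizing f with
  | nil => rfl
  | cons g gs ih => rw [List.foldl_cons, Gate.op, basisOp_mul, ih]; rfl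

theorem Circuit.op_eq_basisOp {q : Type} [Fintype q] [DecidableEq q] (c : Circuit q) :
    c.op = basisOp fun x => c.layers.flatten.foldl (fun x g => g.act x) x := by
  rw [Circuit.op, ← basisOp_id, foldl_op_eq_basisOp]
  rfl

theorem tensor_apply {a b : Type} (A : QOp a) (B : QOp b) (y x : a ⊕ b → Bool) :
    tensor A B y x = A (y ∘ Sum.inl) (x ∘ Sum.inl) * B (y ∘ Sum.inr) (x ∘ Sum.inr) := rfl

theorem sum_ext_iff {a b : Type} {y x : a ⊕ b → Bool} :
    y = x ↔ y ∘ Sum.inl = x ∘ Sum.inl ∧ y ∘ Sum.inr = x ∘ Sum.inr := by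
  refine ⟨by rintro rfl; simp, fun ⟨h1, h2⟩ => ?_⟩
  ext (i | i)
  · exact congrFun h1 i
  · exact congrFun h2 i

theorem tensor_basisOp_one {a b : Type} [Fintype a] [DecidableEq a] [Fintype b] [DecidableEq b]
    (f : (a → Bool) → (a → Bool)) :
    tensor (basisOp f) (1 : QOp b) =
      basisOp fun x => Sum.elim (f (x ∘ Sum.inl)) (x ∘ Sum.inr) := by
  ext y x
  simp only [tensor_apply, basisOp_apply, Matrix.one_apply, sum_ext_iff, Sum.elim_comp_inl,
    Sum.elim_comp_inr]
  simp only [ite_and, ite_mul, one_mul, zero_mul]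

theorem relabel_basisOp {a b : Type} [Fintype a] [DecidableEq a] [Fintype b] [DecidableEq b]
    (e : a ≃ b) (f : (a → Bool) → (a → Bool)) :
    relabel e (basisOp f) = basisOp fun x => f (x ∘ e) ∘ e.symm := by
  ext y x
  simp only [relabel, Matrix.submatrix_apply, basisOp_apply]
  congr 1
  rw [← Equiv.eq_comp_symm]

theorem conjTranspose_relabel_tensor_one {a b c : Type} [Fintype b] [DecidableEq b]
    (e : a ⊕ b ≃ c) (A : QOp a) :
    relabel e (tensor A.conjTranspose (1 : QOp b)) =
      (relabel e (tensor A (1 : QOp b))).conjTranspose := by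
  ext y x
  simp only [relabel, Matrix.submatrix_apply, Matrix.conjTranspose_apply, tensor_apply,
    Matrix.one_apply, star_mul']
  congr 1
  rw [apply_ite star, star_one, star_zero]
  exact if_congr eq_comm rfl rfl

/-- A family of permutations of the basis states of the target register that is trivial unless
the control is set is a controlled strong promise gate. -/
theorem isControlledStrongPromiseGate_basisOp {p t : Type} [Fintype p] [DecidableEq p]
    [Fintype t] [DecidableEq t] (w : (p → Bool) → (t → Bool) → (t → Bool))
    (hw : ∀ j, Function.Injective (w j))
    (f : (Unit ⊕ (p ⊕ t) → Bool) → (Unit ⊕ (p ⊕ t) → Bool))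
    (hf : ∀ x, f x = if x (Sum.inl ()) then
      Sum.elim (x ∘ Sum.inl) (Sum.elim (x ∘ Sum.inr ∘ Sum.inl)
        (w (x ∘ Sum.inr ∘ Sum.inl) (x ∘ Sum.inr ∘ Sum.inr))) else x) :
    IsControlledStrongPromiseGate (basisOp (w fun _ => false)) (basisOp f) := by
  refine ⟨_, ⟨fun j => basisOp (w j), fun j => basisOp_mem_unitaryGroup (hw j), rfl, rfl⟩, ?_⟩
  ext y x
  have hS : (∑ j : p → Bool, tensor (proj j) (basisOp (w j))) (y ∘ Sum.inr) (x ∘ Sum.inr) =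
      if y ∘ Sum.inr = Sum.elim (x ∘ Sum.inr ∘ Sum.inl)
        (w (x ∘ Sum.inr ∘ Sum.inl) (x ∘ Sum.inr ∘ Sum.inr)) then 1 else 0 := by
    rw [Matrix.sum_apply, Finset.sum_eq_single (x ∘ Sum.inr ∘ Sum.inl)]
    · simp only [tensor_apply, proj, Matrix.single_apply, basisOp_apply, sum_ext_iff,
        Function.comp_assoc, Sum.elim_comp_inl, Sum.elim_comp_inr, ite_and]
      simp only [ite_mul, one_mul, zero_mul]
      exact if_congr eq_comm rfl rfl
    · intro j _ hj
      simp only [tensor_apply, proj, Matrix.single_apply, Function.comp_assoc]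
      simp [hj]
    · simp
  have hbool : ∀ z : Unit ⊕ (p ⊕ t) → Bool, ∀ b, (fun _ => b) = z ∘ Sum.inl ↔ z (Sum.inl ()) = b :=
    fun z b => ⟨fun h => (congrFun h ()).symm, fun h => by ext; simp [h]⟩
  rw [controlled, Matrix.add_apply, tensor_apply, tensor_apply, hS, basisOp_apply]
  simp only [proj, Matrix.single_apply, hbool, Matrix.one_apply]
  have hinl : y ∘ Sum.inl = x ∘ Sum.inl ↔ y (Sum.inl ()) = x (Sum.inl ()) :=
    ⟨fun h => congrFun h (), fun h => by ext; simpa using h⟩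
  simp only [hf, sum_ext_iff (y := y)]
  cases hx : x (Sum.inl ()) <;> cases hy : y (Sum.inl ()) <;>
    simp [hinl, hx, hy]

end Operators

/-! ### The ladder and the action of `𝓥₂` on bit strings. -/

section Ladder

theorem ladderMap_of_odd (n : ℕ) (x : Fin (2 * n + 1) → Bool) (i : ℕ) (hi : 2 * i + 1 < 2 * n + 1) :
    ladderMap 2 n x ⟨2 * i + 1, hi⟩ = x ⟨2 * i + 1, hi⟩ := by
  rw [ladderMap, if_neg]
  simp

theorem ladderMap_zero (n : ℕ) (x : Fin (2 * n + 1) → Bool) (h : 0 < 2 * n + 1) :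
    ladderMap 2 n x ⟨0, h⟩ = x ⟨0, h⟩ := by
  rw [ladderMap, if_neg]
  simp

theorem ladderMap_of_even (n : ℕ) (x : Fin (2 * n + 1) → Bool) (i : ℕ)
    (hi : 2 * (i + 1) < 2 * n + 1) :
    ladderMap 2 n x ⟨2 * (i + 1), hi⟩ =
      xor (x ⟨2 * (i + 1), hi⟩) (x ⟨2 * i + 1, by omega⟩ && x ⟨2 * i, by omega⟩) := by
  rw [ladderMap, if_pos ⟨by simp, by simp⟩]
  congr 1
  simp only [Fin.forall_fin_two, Bool.decide_and, Bool.decide_eq_true]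
  rfl

/-- The map is triangular: each bit is changed by a function of lower bits, so the input is
recovered from the bottom up. -/
theorem ladderMap_injective (n : ℕ) : Function.Injective (ladderMap 2 n) := by
  intro x y h
  have key : ∀ i (hi : i < 2 * n + 1), x ⟨i, hi⟩ = y ⟨i, hi⟩ := by
    intro i
    induction i using Nat.strong_induction_on with
    | _ i ih =>
      intro hi
      have hc := congrFun h ⟨i, hi⟩
      obtain ⟨k, rfl | rfl⟩ := i.even_or_odd'
      · cases k with
        | zero => simpa only [Nat.mul_zero, ladderMap_zero] using hc
        | succ k =>
          rw [ladderMap_of_even, ladderMap_of_even, ih (2 * k + 1) (by omega),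
            ih (2 * k) (by omega)] at hc
          simpa using hc
      · simpa only [ladderMap_of_odd] using hc
  ext ⟨i, hi⟩
  exact key i hi

/-- The carry `h₀ = x₀`, `hᵢ = x₂ᵢ ⊕ x₂ᵢ₋₁ hᵢ₋₁`. -/
def carry (x : ℕ → Bool) : ℕ → Bool
  | 0 => x 0
  | i + 1 => xor (x (2 * (i + 1))) (x (2 * i + 1) && carry x i)

/-- A bit string extended by zeros. -/
def extend {N : ℕ} (x : Fin N → Bool) (i : ℕ) : Bool := if h : i < N then x ⟨i, h⟩ else false

theorem extend_of_lt {N : ℕ} (x : Fin N → Bool) {i : ℕ} (h : i < N) : extend x i = x ⟨i, h⟩ :=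
  dif_pos h

theorem carry_congr {x y : ℕ → Bool} {i : ℕ} (h : ∀ j ≤ 2 * i, x j = y j) :
    carry x i = carry y i := by
  induction i with
  | zero => exact h 0 le_rfl
  | succ i ih =>
    rw [carry, carry, h _ le_rfl, h (2 * i + 1) (by omega), ih fun j hj => h j (by omega)]

/-- The carry recursion undoes the ladder: each even bit was modified by its predecessors' product,
and the recursion adds that product back. -/
theorem carry_ladderMap (n : ℕ) (x : Fin (2 * n + 1) → Bool) {i : ℕ} (hi : i ≤ n) :
    carry (extend (ladderMap 2 n x)) i = extend x (2 * i) := by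
  induction i with
  | zero => simp only [carry, Nat.mul_zero, extend_of_lt _ (Nat.succ_pos _), ladderMap_zero]
  | succ i ih =>
    rw [carry, ih (by omega), extend_of_lt _ (by omega : 2 * (i + 1) < 2 * n + 1),
      extend_of_lt _ (by omega : 2 * i + 1 < 2 * n + 1), ladderMap_of_even, ladderMap_of_odd,
      extend_of_lt _ (by omega : 2 * i < 2 * n + 1),
      extend_of_lt _ (by omega : 2 * (i + 1) < 2 * n + 1)]
    simp

/-- The action of `𝓥₂⁽ᵐ⁺¹⁾` on bit strings. -/
def vMap (m : ℕ) (x : Fin (2 * (m + 1) + 1) → Bool) : Fin (2 * (m + 1) + 1) → Bool :=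
  Function.update x (Fin.last _)
    (xor (x (Fin.last _)) (extend x (2 * m + 1) && carry (extend x) m))

/-- By unitarity it suffices to check `𝓛⁽ᵐ⁺¹⁾ = 𝓥 (𝓛⁽ᵐ⁾ ⊗ I)`, which avoids inverting the ladder.
After the shorter ladder, the carry at `m` is the original bit `x₂ₘ`. -/
theorem vOp_two_succ (m : ℕ) : vOp 2 (m + 1) = basisOp (vMap m) := by
  have hu : relabel (splitEquiv 2 m) (tensor (ladderOp 2 m) (1 : QOp (Fin 2))) ∈
      Matrix.unitaryGroup _ ℂ := by
    rw [ladderOp, tensor_basisOp_one, relabel_basisOp]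
    refine basisOp_mem_unitaryGroup fun x y h => ?_
    have h' := (splitEquiv 2 m).symm.surjective.injective_comp_right h
    rw [sum_ext_iff] at h'
    simp only [Sum.elim_comp_inl, Sum.elim_comp_inr] at h'
    have h'' : x ∘ splitEquiv 2 m = y ∘ splitEquiv 2 m :=
      sum_ext_iff.2 ⟨ladderMap_injective m h'.1, h'.2⟩
    exact (splitEquiv 2 m).surjective.injective_comp_right h''
  have hmul : ladderOp 2 (m + 1) =
      basisOp (vMap m) * relabel (splitEquiv 2 m) (tensor (ladderOp 2 m) (1 : QOp (Fin 2))) := by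
    rw [ladderOp, ladderOp, tensor_basisOp_one, relabel_basisOp, basisOp_mul]
    congr 1
    ext x ⟨i, hi⟩
    set y := Sum.elim (ladderMap 2 m ((x ∘ splitEquiv 2 m) ∘ Sum.inl))
      ((x ∘ splitEquiv 2 m) ∘ Sum.inr) ∘ (splitEquiv 2 m).symm with hy
    have hy1 : ∀ j (hj : j < 2 * m + 1), y ⟨j, by omega⟩ =
        ladderMap 2 m (fun k => x ⟨k, by omega⟩) ⟨j, hj⟩ := by
      intro j hj
      have : (⟨j, by omega⟩ : Fin (2 * (m + 1) + 1)) = splitEquiv 2 m (Sum.inl ⟨j, hj⟩) := rfl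
      rw [hy, this]
      simp only [Function.comp_apply, Equiv.symm_apply_apply, Sum.elim_inl]
      rfl
    have hy2 : ∀ j (hj : j < 2), y ⟨2 * m + 1 + j, by omega⟩ = x ⟨2 * m + 1 + j, by omega⟩ := by
      intro j hj
      have : (⟨2 * m + 1 + j, by omega⟩ : Fin (2 * (m + 1) + 1)) =
        splitEquiv 2 m (Sum.inr ⟨j, hj⟩) := rfl
      rw [hy, this]
      simp only [Function.comp_apply, Equiv.symm_apply_apply, Sum.elim_inr]
    change _ = vMap m y _
    by_cases h : i = 2 * (m + 1)
    · subst h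
      rw [ladderMap_of_even, vMap]
      change _ = Function.update y (Fin.last _) _ (Fin.last _)
      rw [Function.update_self, extend_of_lt _ (by omega)]
      have hc : carry (extend y) m = x ⟨2 * m, by omega⟩ := by
        rw [carry_congr (y := extend (ladderMap 2 m fun k => x ⟨k, by omega⟩)),
          carry_ladderMap m _ le_rfl, extend_of_lt _ (by omega)]
        intro j hj
        rw [extend_of_lt _ (by omega), extend_of_lt _ (by omega), hy1 j (by omega)]
      rw [hc, hy2 0 (by omega)]
      congr 1
      exact (hy2 1 (by omega)).symm
    · have hne : (⟨i, hi⟩ : Fin (2 * (m + 1) + 1)) ≠ Fin.last _ := fun h' => h (congrArg Fin.val h')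
      rw [vMap, Function.update_of_ne hne]
      by_cases h1 : i = 2 * m + 1
      · subst h1
        rw [ladderMap_of_odd]
        exact (hy2 0 (by omega)).symm
      · rw [hy1 i (by omega)]
        obtain ⟨k, rfl | rfl⟩ := i.even_or_odd'
        · cases k with
          | zero => simp only [Nat.mul_zero, ladderMap_zero]
          | succ k => rw [ladderMap_of_even, ladderMap_of_even]
        · rw [ladderMap_of_odd, ladderMap_of_odd]
  rw [vOp, conjTranspose_relabel_tensor_one, hmul, Matrix.mul_assoc, ← Matrix.star_eq_conjTranspose,
    (Matrix.mem_unitaryGroup_iff.1 hu), Matrix.mul_one]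

end Ladder

/-! ### Trees of work qubits and trees of affine maps. -/

section Trees

variable {q : Type}

/-- Binary trees of qubits. -/
inductive PTree (q : Type) : Type
  | leaf (p : q) : PTree q
  | node (p : q) (l r : PTree q) : PTree q

namespace PTree

/-- The number of leaves. -/
def leaves : PTree q → ℕ
  | leaf _ => 1
  | node _ l r => l.leaves + r.leaves

/-- The label of the root. -/
def root : PTree q → q
  | leaf p => p
  | node p _ _ => p

/-- Replacement of the label of the root. -/
def setRoot (z : q) : PTree q → PTree q
  | leaf _ => leaf z
  | node _ l r => node z l r

/-- All labels, in preorder. -/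
def toList : PTree q → List q
  | leaf p => [p]
  | node p l r => p :: (l.toList ++ r.toList)

/-- All labels except that of the root. -/
def tail : PTree q → List q
  | leaf _ => []
  | node _ l r => l.toList ++ r.toList

/-- A tree of height at most `h` whose labels at level `k` are available at time `T + 4 k`. -/
def Avail (τ : q → ℕ) (T : ℕ) : PTree q → ℕ → Prop
  | leaf p, h => τ p ≤ T + 4 * h
  | node _ _ _, 0 => False
  | node p l r, h + 1 => τ p ≤ T + 4 * (h + 1) ∧ Avail τ T l h ∧ Avail τ T r h

theorem toList_eq (t : PTree q) : t.toList = t.root :: t.tail := by cases t <;> rfl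

@[simp] theorem toList_setRoot (z : q) (t : PTree q) : (t.setRoot z).toList = z :: t.tail := by
  cases t <;> rfl

@[simp] theorem leaves_setRoot (z : q) (t : PTree q) : (t.setRoot z).leaves = t.leaves := by
  cases t <;> rfl

theorem leaves_pos (t : PTree q) : 0 < t.leaves := by
  induction t with
  | leaf => exact one_pos
  | node _ _ _ ih _ => exact Nat.add_pos_left ih _

/-- The root slope must survive as a control, so a fresh qubit takes its place when the tree is
reused. -/
theorem Avail.setRoot {τ : q → ℕ} {T h : ℕ} {t : PTree q} {z : q} (ht : t.Avail τ T h)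
    (hz : τ z = 0) : (t.setRoot z).Avail τ T h := by
  cases t with
  | leaf p => simp [PTree.setRoot, Avail, hz]
  | node p l r =>
    cases h with
    | zero => exact ht.elim
    | succ h => exact ⟨by simp [hz], ht.2⟩

theorem Avail.congr {τ τ' : q → ℕ} {T h : ℕ} {t : PTree q} (ht : t.Avail τ T h)
    (hτ : ∀ i ∈ t.toList, τ' i = τ i) : t.Avail τ' T h := by
  induction t generalizing h with
  | leaf p => simpa [Avail, hτ p (by simp [toList])] using ht
  | node p l r ihl ihr =>
    cases h with
    | zero => exact ht.elim
    | succ h =>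
      refine ⟨?_, ihl ht.2.1 fun i hi => hτ i ?_, ihr ht.2.2 fun i hi => hτ i ?_⟩
      · rw [hτ p (by simp [toList])]
        exact ht.1
      · simp [toList, hi]
      · simp [toList, hi]

/-- A merge touches the slope tree of each subtree only at its root. -/
theorem Avail.of_tail {τ τ' : q → ℕ} {T h : ℕ} {t : PTree q} (ht : t.Avail τ T h)
    (hτ : ∀ i ∈ t.tail, τ' i = τ i) (hr : τ' t.root ≤ T + 4 * h) : t.Avail τ' T h := by
  cases t with
  | leaf p => exact hr
  | node p l r =>
    cases h with
    | zero => exact ht.elim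
    | succ h =>
      exact ⟨hr,
        ht.2.1.congr fun i hi => hτ i (by simp [tail, hi]),
        ht.2.2.congr fun i hi => hτ i (by simp [tail, hi])⟩

end PTree

/-- Binary trees whose leaves are entries `(g, p)` and whose inner nodes are work qubits. -/
inductive BTree (q : Type) : Type
  | leaf (g p : q) : BTree q
  | node (z : q) (l r : BTree q) : BTree q

/-- The qubits of a list of entries. -/
def flat (E : List (q × q)) : List q := E.flatMap fun e => [e.1, e.2]

@[simp] theorem flat_nil : flat ([] : List (q × q)) = [] := rfl

@[simp] theorem flat_cons (e : q × q) (E : List (q × q)) : flat (e :: E) = e.1 :: e.2 :: flat E :=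
  rfl

@[simp] theorem flat_append (E E' : List (q × q)) : flat (E ++ E') = flat E ++ flat E' :=
  List.flatMap_append

/-- The composition of the affine maps `c ↦ g ⊕ p c` of a list of entries `(g, p)`. -/
def evalEntries (x : q → Bool) (E : List (q × q)) (c : Bool) : Bool :=
  E.foldr (fun e c => xor (x e.1) (x e.2 && c)) c

theorem evalEntries_append (x : q → Bool) (E E' : List (q × q)) (c : Bool) :
    evalEntries x (E ++ E') c = evalEntries x E (evalEntries x E' c) := List.foldr_append

theorem evalEntries_congr {x y : q → Bool} {E : List (q × q)} (h : ∀ i ∈ flat E, x i = y i)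
    (c : Bool) : evalEntries x E c = evalEntries y E c := by
  induction E with
  | nil => rfl
  | cons e E ih =>
    simp only [flat_cons, List.mem_cons] at h
    change xor (x e.1) (x e.2 && evalEntries x E c) = xor (y e.1) (y e.2 && evalEntries y E c)
    rw [h e.1 (by simp), h e.2 (by simp), ih fun i hi => h i (by simp [hi])]

namespace BTree

/-- The qubit that receives the constant part of the composition. -/
def rootG : BTree q → q
  | leaf g _ => g
  | node _ l _ => l.rootG

/-- The qubit that receives the product of the slopes. -/
def rootP : BTree q → q
  | leaf _ p => p
  | node z _ _ => z

/-- The entries, from left to right. -/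
def entries : BTree q → List (q × q)
  | leaf g p => [(g, p)]
  | node _ l r => l.entries ++ r.entries

/-- The work qubits. -/
def inner : BTree q → List q
  | leaf _ _ => []
  | node z l r => z :: (l.inner ++ r.inner)

/-- All qubits. -/
def qubits : BTree q → List q
  | leaf g p => [g, p]
  | node z l r => z :: (l.qubits ++ r.qubits)

/-- The tree of the qubits that receive products of slopes. -/
def labels : BTree q → PTree q
  | leaf _ p => .leaf p
  | node z l r => .node z l.labels r.labels

/-- A tree of height at most `h` whose leaves are available at time `T` and whose work qubits at
level `k + 1` are available at time `T + 4 k`. -/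
def Avail (τ : q → ℕ) (T : ℕ) : BTree q → ℕ → Prop
  | leaf g p, _ => τ g ≤ T ∧ τ p ≤ T
  | node _ _ _, 0 => False
  | node z l r, h + 1 => τ z ≤ T + 4 * h ∧ Avail τ T l h ∧ Avail τ T r h

theorem Avail.congr {τ τ' : q → ℕ} {T h : ℕ} {b : BTree q} (hb : b.Avail τ T h)
    (hτ : ∀ i ∈ b.qubits, τ' i = τ i) : b.Avail τ' T h := by
  induction b generalizing h with
  | leaf g p => simpa [Avail, hτ g (by simp [qubits]), hτ p (by simp [qubits])] using hb
  | node z l r ihl ihr =>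
    cases h with
    | zero => exact hb.elim
    | succ h =>
      refine ⟨?_, ihl hb.2.1 fun i hi => hτ i ?_, ihr hb.2.2 fun i hi => hτ i ?_⟩
      · rw [hτ z (by simp [qubits])]
        exact hb.1
      · simp [qubits, hi]
      · simp [qubits, hi]

@[simp] theorem root_labels (b : BTree q) : b.labels.root = b.rootP := by cases b <;> rfl

theorem leaves_labels (b : BTree q) : b.labels.leaves = b.entries.length := by
  induction b with
  | leaf => rfl
  | node z l r ihl ihr => simp [labels, PTree.leaves, entries, ihl, ihr]

theorem rootG_mem (b : BTree q) : b.rootG ∈ b.qubits := by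
  induction b with
  | leaf => simp [rootG, qubits]
  | node z l r ihl ihr => simp [rootG, qubits, ihl]

theorem inner_subset (b : BTree q) : b.inner ⊆ b.qubits := by
  induction b with
  | leaf => simp [inner]
  | node z l r ihl ihr =>
    intro i
    simp only [inner, qubits, List.mem_cons, List.mem_append]
    exact Or.imp_right (Or.imp (@ihl i) (@ihr i))

theorem flat_entries_subset (b : BTree q) : flat b.entries ⊆ b.qubits := by
  induction b with
  | leaf => simp [entries, qubits]
  | node z l r ihl ihr =>
    intro i
    simp only [entries, flat_append, qubits, List.mem_cons, List.mem_append]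
    exact fun h => Or.inr (h.imp (@ihl i) (@ihr i))

theorem labels_sublist (b : BTree q) : b.labels.toList.Sublist b.qubits := by
  induction b with
  | leaf g p => exact List.sublist_cons_self _ _
  | node z l r ihl ihr => exact (ihl.append ihr).cons_cons z

theorem labels_subset (b : BTree q) : b.labels.toList ⊆ b.qubits :=
  b.labels_sublist.subset

theorem rootP_mem (b : BTree q) : b.rootP ∈ b.qubits :=
  b.labels_subset (by simp [PTree.toList_eq])

theorem tail_subset (b : BTree q) : b.labels.tail ⊆ b.qubits := fun i hi =>
  b.labels_subset (by simp [PTree.toList_eq, hi])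

theorem qubits_perm (b : BTree q) : b.qubits.Perm (b.inner ++ flat b.entries) := by
  induction b with
  | leaf => simp [qubits, inner, entries]
  | node z l r ihl ihr =>
    simp only [qubits, inner, entries, flat_append, List.cons_append]
    refine List.Perm.cons z ((ihl.append ihr).trans ?_)
    simp only [List.append_assoc]
    refine List.Perm.append_left _ ?_
    rw [← List.append_assoc, ← List.append_assoc]
    exact List.Perm.append_right _ List.perm_append_comm

theorem nodup_labels {b : BTree q} (hb : b.qubits.Nodup) :
    b.labels.toList.Nodup ∧ b.rootG ∉ b.labels.toList := by
  induction b with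
  | leaf g p => simpa [labels, PTree.toList, qubits, rootG] using hb
  | node z l r ihl ihr =>
    rw [qubits, List.nodup_cons, List.nodup_append', List.mem_append, not_or] at hb
    obtain ⟨⟨hzl, hzr⟩, hl, hr, hlr⟩ := hb
    simp only [labels, PTree.toList, rootG, List.nodup_cons, List.nodup_append', List.mem_append,
      List.mem_cons, not_or]
    refine ⟨⟨⟨fun h => hzl (l.labels_subset h), fun h => hzr (r.labels_subset h)⟩, (ihl hl).1,
      (ihr hr).1, fun i hi hi' => hlr (l.labels_subset hi) (r.labels_subset hi')⟩,
      fun h => hzl (h ▸ l.rootG_mem), (ihl hl).2,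
      fun h => hlr l.rootG_mem (r.labels_subset h)⟩

theorem rootP_notMem_tail {b : BTree q} (hb : b.qubits.Nodup) : b.rootP ∉ b.labels.tail := by
  have h := (nodup_labels hb).1
  rw [PTree.toList_eq, List.nodup_cons, root_labels] at h
  exact h.1

theorem rootG_notMem_tail {b : BTree q} (hb : b.qubits.Nodup) : b.rootG ∉ b.labels.tail := by
  have h := (nodup_labels hb).2
  rw [PTree.toList_eq] at h
  exact fun h' => h (List.mem_cons_of_mem _ h')

theorem rootG_ne_rootP {b : BTree q} (hb : b.qubits.Nodup) : b.rootG ≠ b.rootP := by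
  have h := (nodup_labels hb).2
  rw [PTree.toList_eq, List.mem_cons, root_labels, not_or] at h
  exact h.1

end BTree

/-- A nonempty list of at most `2 * t.leaves` entries forms the leaves of a tree whose work qubits
are taken from `t`. -/
theorem PTree.exists_bTree (t : PTree q) (E : List (q × q)) (hE : E ≠ [])
    (hlen : E.length ≤ 2 * t.leaves) {τ : q → ℕ} {T h : ℕ} (ht : t.Avail τ T h)
    (hτ : ∀ i ∈ flat E, τ i ≤ T) :
    ∃ b : BTree q, b.entries = E ∧ b.inner.Sublist t.toList ∧ b.Avail τ T (h + 1) := by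
  induction t generalizing E h with
  | leaf p =>
    match E, hE, hlen, hτ with
    | [e], _, _, hτ =>
      simp only [flat_cons, List.mem_cons] at hτ
      exact ⟨.leaf e.1 e.2, rfl, List.nil_sublist _, hτ _ (by simp), hτ _ (by simp)⟩
    | [e, e'], _, _, hτ =>
      simp only [flat_cons, List.mem_cons] at hτ
      -- Each leaf of the work tree becomes a merge of two entries, hence the factor `2` in the
      -- capacity and the extra level of height.
      refine ⟨.node p (.leaf e.1 e.2) (.leaf e'.1 e'.2), rfl, List.Sublist.refl _, ht, ?_, ?_⟩
      · exact ⟨hτ _ (by simp), hτ _ (by simp)⟩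
      · exact ⟨hτ _ (by simp), hτ _ (by simp)⟩
    | _ :: _ :: _ :: _, _, hlen, _ =>
      simp only [List.length_cons, leaves] at hlen
      omega
  | node p l r ihl ihr =>
    cases h with
    | zero => exact ht.elim
    | succ h =>
      by_cases h1 : E.length ≤ 1
      · match E, hE, hτ, h1 with
        | [e], _, hτ, _ =>
          simp only [flat_cons, List.mem_cons] at hτ
          exact ⟨.leaf e.1 e.2, rfl, List.nil_sublist _, hτ _ (by simp), hτ _ (by simp)⟩
      · rw [leaves] at hlen
        have hl := l.leaves_pos
        have hr := r.leaves_pos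
        -- Fill the left subtree as far as possible, but leave at least one entry for the right one.
        set k := min (E.length - 1) (2 * l.leaves) with hk
        have hflat : flat E = flat (E.take k) ++ flat (E.drop k) := by
          rw [← flat_append, List.take_append_drop]
        rw [hflat] at hτ
        obtain ⟨b₁, e₁, s₁, a₁⟩ := ihl (E.take k)
          (List.ne_nil_of_length_pos (by rw [List.length_take]; omega))
          (by rw [List.length_take]; omega) ht.2.1 fun i hi => hτ i (by simp [hi])
        obtain ⟨b₂, e₂, s₂, a₂⟩ := ihr (E.drop k)
          (List.ne_nil_of_length_pos (by rw [List.length_drop]; omega))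
          (by rw [List.length_drop]; omega) ht.2.2 fun i hi => hτ i (by simp [hi])
        refine ⟨.node p b₁ b₂, ?_, (s₁.append s₂).cons_cons p, ht.1, a₁, a₂⟩
        rw [BTree.entries, e₁, e₂, List.take_append_drop]

end Trees

/-! ### Evaluating compositions of affine maps with recycled qubits. -/

section Programs

variable {q : Type} [DecidableEq q]

/-- A crude bound, as if the gates ran one after another; applied to the four gates of a merge, it
yields the cost `4` per tree level. -/
theorem runTime_le {gs : List (Gate q)} {τ : q → ℕ} {B : ℕ}
    (h : ∀ g ∈ gs, ∀ i ∈ g.qubits, τ i ≤ B) (i : q) :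
    runTime gs τ i ≤ max (τ i) (B + gs.length) := by
  induction gs generalizing τ B with
  | nil => exact le_max_left _ _
  | cons g gs ih =>
    have hg : ∀ i, g.time τ i ≤ max (τ i) (B + 1) :=
      g.time_le fun i hi => Nat.succ_le_succ (h g (by simp) i hi)
    have := ih (τ := g.time τ) (B := B + 1) fun g' hg' i hi => by
      have := hg i
      have := h g' (by simp [hg']) i hi
      omega
    have := hg i
    rw [runTime_cons, List.length_cons]
    omega

/-- The composition of the entries of a tree can be computed in its root qubits. -/
theorem BTree.exists_gates (b : BTree q) (hb : b.qubits.Nodup) {τ : q → ℕ} {T h : ℕ}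
    (hτ : b.Avail τ T h) : ∃ gs : List (Gate q),
      (∀ g ∈ gs, ∀ i ∈ g.qubits, i ∈ b.qubits) ∧
      gs.length + 4 ≤ 4 * b.entries.length ∧
      (∀ x, (∀ i ∈ b.inner, x i = false) →
        (∀ c, evalEntries x b.entries c =
          xor (runGates gs x b.rootG) (runGates gs x b.rootP && c)) ∧
        (runGates gs x b.rootP = true → ∀ i ∈ b.labels.tail, runGates gs x i = false)) ∧
      (∀ i, runTime gs τ i ≤ max (τ i) (T + 4 * h)) ∧
      runTime gs τ b.rootG ≤ T + 4 * h ∧ runTime gs τ b.rootP ≤ T + 4 * h ∧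
      b.labels.Avail (runTime gs τ) (T + 4) h := by
  induction b generalizing τ h with
  | leaf g p =>
    refine ⟨[], by simp, by simp [entries], fun x _ => ⟨fun c => rfl, by simp [labels, PTree.tail]⟩,
      by simp, ?_, ?_, ?_⟩
    · exact hτ.1.trans (Nat.le_add_right _ _)
    · exact hτ.2.trans (Nat.le_add_right _ _)
    · have := hτ.2
      simp only [labels, PTree.Avail, runTime_nil]
      omega
  | node z l r ihl ihr =>
    cases h with
    | zero => exact hτ.elim
    | succ h =>
      rw [qubits, List.nodup_cons, List.nodup_append', List.mem_append, not_or] at hb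
      obtain ⟨⟨hzl, hzr⟩, hl, hr, hlr⟩ := hb
      obtain ⟨gs₁, sub₁, len₁, sem₁, time₁, timeG₁, timeP₁, av₁⟩ := ihl hl hτ.2.1
      have frame₁ : ∀ i ∉ l.qubits, ∀ g ∈ gs₁, i ∉ g.qubits := fun i hi g hg hi' =>
        hi (sub₁ g hg i hi')
      have hr_l : ∀ i ∈ r.qubits, i ∉ l.qubits := fun i hi hi' => hlr hi' hi
      obtain ⟨gs₂, sub₂, len₂, sem₂, time₂, timeG₂, timeP₂, av₂⟩ := ihr hr (τ := runTime gs₁ τ)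
        (hτ.2.2.congr fun i hi => runTime_apply_of_notMem (frame₁ i (hr_l i hi)) τ)
      have frame₂ : ∀ i ∉ r.qubits, ∀ g ∈ gs₂, i ∉ g.qubits := fun i hi g hg hi' =>
        hi (sub₂ g hg i hi')
      have hl_r : ∀ i ∈ l.qubits, i ∉ r.qubits := fun i hi hi' => hlr hi hi'
      have neGP := rootG_ne_rootP hl
      have ne₁ : l.rootG ≠ r.rootG := fun h => hlr l.rootG_mem (h ▸ r.rootG_mem)
      have ne₂ : l.rootG ≠ r.rootP := fun h => hlr l.rootG_mem (h ▸ r.rootP_mem)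
      have ne₃ : l.rootP ≠ r.rootG := fun h => hlr l.rootP_mem (h ▸ r.rootG_mem)
      have ne₄ : l.rootP ≠ r.rootP := fun h => hlr l.rootP_mem (h ▸ r.rootP_mem)
      have ne₅ : z ≠ l.rootG := fun h => hzl (h ▸ l.rootG_mem)
      have ne₆ : z ≠ l.rootP := fun h => hzl (h ▸ l.rootP_mem)
      have ne₈ : z ≠ r.rootP := fun h => hzr (h ▸ r.rootP_mem)
      -- The merge: constant part `g ⊕ p g'` in place, slope `p p'` into the clean qubit `z`, then
      -- both old slopes negated so that they become `0` whenever `z` is `1`.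
      obtain ⟨ms, hms⟩ : ∃ ms : List (Gate q), ms =
        [.CCX l.rootP r.rootG l.rootG ne₃ neGP.symm ne₁.symm,
          .CCX l.rootP r.rootP z ne₄ ne₆.symm ne₈.symm, .X l.rootP, .X r.rootP] := ⟨_, rfl⟩
      have subm : ∀ g ∈ ms, ∀ i ∈ g.qubits,
          i = z ∨ i = l.rootG ∨ i = l.rootP ∨ i = r.rootG ∨ i = r.rootP := by
        simp only [hms, List.forall_mem_cons, Gate.qubits, Finset.mem_insert, Finset.mem_singleton]
        refine ⟨?_, ?_, ?_, ?_, by simp⟩ <;> intro i hi <;> tauto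
      have hG : ∀ y, runGates ms y l.rootG = xor (y l.rootG) (y l.rootP && y r.rootG) := by
        intro y
        simp [hms, Gate.act, Function.update_apply, neGP, ne₂, ne₅.symm]
      have hZ : ∀ y, runGates ms y z = xor (y z) (y l.rootP && y r.rootP) := by
        intro y
        simp [hms, Gate.act, Function.update_apply, neGP.symm, ne₂.symm, ne₅, ne₆, ne₈]
      have hP : ∀ y, runGates ms y l.rootP = !(y l.rootP) := by
        intro y
        simp [hms, Gate.act, Function.update_apply, neGP.symm, ne₄, ne₆.symm]
      have hP' : ∀ y, runGates ms y r.rootP = !(y r.rootP) := by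
        intro y
        simp [hms, Gate.act, Function.update_apply, ne₄.symm, ne₂.symm, ne₈.symm]
      have framem : ∀ i, i ∈ l.labels.tail ∨ i ∈ r.labels.tail → ∀ g ∈ ms, i ∉ g.qubits := by
        intro i hi g hg hig
        have hiz : i ≠ z := by
          rintro rfl
          exact hi.elim (fun h => hzl (l.tail_subset h)) fun h => hzr (r.tail_subset h)
        rcases hi with hi | hi
        · rcases subm g hg i hig with h | h | h | h | h
          · exact hiz h
          · exact rootG_notMem_tail hl (h ▸ hi)
          · exact rootP_notMem_tail hl (h ▸ hi)
          · exact hlr (l.tail_subset hi) (h ▸ r.rootG_mem)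
          · exact hlr (l.tail_subset hi) (h ▸ r.rootP_mem)
        · rcases subm g hg i hig with h | h | h | h | h
          · exact hiz h
          · exact hlr (h ▸ l.rootG_mem) (r.tail_subset hi)
          · exact hlr (h ▸ l.rootP_mem) (r.tail_subset hi)
          · exact rootG_notMem_tail hr (h ▸ hi)
          · exact rootP_notMem_tail hr (h ▸ hi)
      set τ₂ := runTime gs₂ (runTime gs₁ τ) with hτ₂
      have htl : ∀ i ∈ l.qubits, τ₂ i = runTime gs₁ τ i := fun i hi =>
        runTime_apply_of_notMem (frame₂ i (hl_r i hi)) _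
      have htz : τ₂ z = τ z := by
        rw [hτ₂, runTime_apply_of_notMem (frame₂ z hzr), runTime_apply_of_notMem (frame₁ z hzl)]
      have timem : ∀ i, runTime ms τ₂ i ≤ max (τ₂ i) (T + 4 * (h + 1)) := by
        intro i
        refine (runTime_le (B := T + 4 * h) (fun g hg i hi => ?_) i).trans_eq ?_
        · rcases subm g hg i hi with rfl | rfl | rfl | rfl | rfl
          · rw [htz]; exact hτ.1
          · rw [htl _ l.rootG_mem]; exact timeG₁
          · rw [htl _ l.rootP_mem]; exact timeP₁
          · exact timeG₂
          · exact timeP₂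
        · rw [hms]; rfl
      have htime : runTime (gs₁ ++ gs₂ ++ ms) τ = runTime ms τ₂ := by
        rw [runTime_append, runTime_append]
      have bG : runTime ms τ₂ l.rootG ≤ T + 4 * (h + 1) := by
        have := timem l.rootG
        rw [htl _ l.rootG_mem] at this
        omega
      have bP : runTime ms τ₂ l.rootP ≤ T + 4 * (h + 1) := by
        have := timem l.rootP
        rw [htl _ l.rootP_mem] at this
        omega
      have bP' : runTime ms τ₂ r.rootP ≤ T + 4 * (h + 1) := by
        have := timem r.rootP
        omega
      have bZ : runTime ms τ₂ z ≤ T + 4 * (h + 1) := by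
        have := timem z
        have := hτ.1
        omega
      refine ⟨gs₁ ++ gs₂ ++ ms, ?_, ?_, fun x hx => ?_, fun i => ?_,
        htime ▸ bG, htime ▸ bZ, ?_, ?_, ?_⟩
      · intro g hg i hi
        rw [List.mem_append, List.mem_append] at hg
        simp only [qubits, List.mem_cons, List.mem_append]
        rcases hg with (hg | hg) | hg
        · exact Or.inr (Or.inl (sub₁ g hg i hi))
        · exact Or.inr (Or.inr (sub₂ g hg i hi))
        · rcases subm g hg i hi with rfl | rfl | rfl | rfl | rfl
          · exact Or.inl rfl
          · exact Or.inr (Or.inl l.rootG_mem)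
          · exact Or.inr (Or.inl l.rootP_mem)
          · exact Or.inr (Or.inr r.rootG_mem)
          · exact Or.inr (Or.inr r.rootP_mem)
      · have hml : ms.length = 4 := by rw [hms]; rfl
        simp only [List.length_append, entries, hml]
        omega
      · simp only [inner, List.mem_cons, List.mem_append] at hx
        set x₁ := runGates gs₁ x with hx₁
        set x₂ := runGates gs₂ x₁ with hx₂
        have hrun : runGates (gs₁ ++ gs₂ ++ ms) x = runGates ms x₂ := by
          rw [runGates_append, runGates_append]
        have hr₁ : ∀ i ∈ r.qubits, x₁ i = x i := fun i hi =>
          runGates_apply_of_notMem (frame₁ i (hr_l i hi)) _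
        have hl₂ : ∀ i ∈ l.qubits, x₂ i = x₁ i := fun i hi =>
          runGates_apply_of_notMem (frame₂ i (hl_r i hi)) _
        have hz₂ : x₂ z = false := by
          rw [hx₂, runGates_apply_of_notMem (frame₂ z hzr), hx₁,
            runGates_apply_of_notMem (frame₁ z hzl), hx z (by simp)]
        obtain ⟨ev₁, cl₁⟩ := sem₁ x fun i hi => hx i (by simp [hi])
        obtain ⟨ev₂, cl₂⟩ := sem₂ x₁ fun i hi => by
          rw [hr₁ i (r.inner_subset hi)]
          exact hx i (by simp [hi])
        rw [hrun]
        change (∀ c, _ = xor (runGates ms x₂ l.rootG) (runGates ms x₂ z && c)) ∧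
          (runGates ms x₂ z = true →
            ∀ i ∈ l.labels.toList ++ r.labels.toList, runGates ms x₂ i = false)
        simp only [hG, hZ, hz₂, Bool.false_xor]
        refine ⟨fun c => ?_, fun hpp i hi => ?_⟩
        · rw [entries, evalEntries_append, ev₁,
            ← evalEntries_congr fun i hi => hr₁ i (r.flat_entries_subset hi), ev₂,
            hl₂ _ l.rootG_mem, hl₂ _ l.rootP_mem, ← hx₁, ← hx₂]
          cases x₁ l.rootP <;> simp
        · rw [Bool.and_eq_true] at hpp
          simp only [List.mem_append, PTree.toList_eq, List.mem_cons, root_labels] at hi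
          rcases hi with (rfl | hi) | (rfl | hi)
          · rw [hP, hpp.1]; rfl
          · rw [runGates_apply_of_notMem (framem i (Or.inl hi)), hl₂ i (l.tail_subset hi)]
            exact cl₁ (by rw [← hx₁, ← hl₂ _ l.rootP_mem, hpp.1]) i hi
          · rw [hP', hpp.2]; rfl
          · rw [runGates_apply_of_notMem (framem i (Or.inr hi))]
            exact cl₂ hpp.2 i hi
      · rw [htime]
        have h₁ := timem i
        have h₂ := time₂ i
        have h₃ := time₁ i
        omega
      · rw [htime]
        omega
      · rw [htime]
        refine av₁.of_tail (fun i hi => ?_) (by rw [root_labels]; omega)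
        rw [runTime_apply_of_notMem (framem i (Or.inl hi)), htl i (l.tail_subset hi)]
      · rw [htime]
        refine av₂.of_tail (fun i hi => ?_) (by rw [root_labels]; omega)
        rw [runTime_apply_of_notMem (framem i (Or.inr hi))]

/-- The composition of a list of entries can be evaluated at a qubit `a` in logarithmic depth with
the clean work qubits `t` and `zs`. -/
theorem exists_gates_evalEntries (zs : List q) (t : PTree q) (E : List (q × q)) (a : q)
    {τ : q → ℕ} {T h : ℕ} (hnd : (zs ++ t.toList ++ flat E ++ [a]).Nodup)
    (hlen : E.length ≤ 2 * t.leaves * (2 ^ (zs.length + 1) - 1)) (ht : t.Avail τ T h)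
    (hzs : ∀ i ∈ zs, τ i = 0) (hE : ∀ i ∈ flat E, τ i = 0) (ha : τ a = 0) :
    ∃ (gs : List (Gate q)) (r : q),
      r ∈ zs ++ t.toList ++ flat E ++ [a] ∧
      (∀ g ∈ gs, ∀ i ∈ g.qubits, i ∈ zs ++ t.toList ++ flat E ++ [a]) ∧
      gs.length ≤ 4 * E.length ∧
      (∀ x, (∀ i ∈ zs, x i = false) → (∀ i ∈ t.toList, x i = false) →
        runGates gs x r = evalEntries x E (x a)) ∧
      (∀ i, runTime gs τ i ≤ max (τ i) (T + 4 * h + 9 * zs.length + 13)) ∧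
      runTime gs τ r ≤ T + 4 * h + 9 * zs.length + 13 := by
  induction hm : zs.length using Nat.strong_induction_on generalizing zs t E τ T h with
  | _ m ih =>
  by_cases hE0 : E = []
  · subst hE0
    exact ⟨[], a, by simp, by simp, by simp, fun x _ _ => rfl, by simp, by simp [ha]⟩
  set E₁ := E.take (2 * t.leaves) with hE₁
  set E₂ := E.drop (2 * t.leaves) with hE₂
  have hE12 : E = E₁ ++ E₂ := (List.take_append_drop _ _).symm
  have hlen₁ : E₁.length = min (2 * t.leaves) E.length := List.length_take
  have hlen₂ : E₂.length = E.length - 2 * t.leaves := List.length_drop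
  have htpos := t.leaves_pos
  have hEpos := List.length_pos_of_ne_nil hE0
  rw [hE12, flat_append] at hnd hE
  obtain ⟨b, hbE, hbi, hbav⟩ := t.exists_bTree E₁ (List.ne_nil_of_length_pos (by omega))
    (by omega) ht fun i hi => by simp [hE i (by simp [hi])]
  have hperm := b.qubits_perm
  rw [hbE] at hperm
  have hmem : ∀ i, i ∈ b.qubits → i ∈ t.toList ∨ i ∈ flat E₁ := fun i hi =>
    (List.mem_append.1 (hperm.mem_iff.1 hi)).imp_left fun h => hbi.subset h
  obtain ⟨hbnd, hrest⟩ : b.qubits.Nodup ∧ (zs ++ b.qubits ++ flat E₂ ++ [a]).Nodup := by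
    have h1 : (zs ++ (b.inner ++ flat E₁) ++ flat E₂ ++ [a]).Nodup := by
      refine hnd.sublist ?_
      simp only [List.append_assoc]
      exact List.Sublist.append_left (List.Sublist.append_right hbi _) _
    have h2 : (zs ++ b.qubits ++ flat E₂ ++ [a]).Nodup :=
      (((hperm.append_left zs).append_right (flat E₂)).append_right [a]).nodup_iff.2 h1
    refine ⟨h2.sublist ?_, h2⟩
    simp only [List.append_assoc]
    exact (List.sublist_append_left _ _).trans (List.sublist_append_right _ _)
  have hdisj : ∀ i, i ∈ b.qubits → i ∉ zs ∧ i ∉ flat E₂ ∧ i ≠ a := by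
    intro i hi
    simp only [List.nodup_append', List.disjoint_left, List.mem_append, List.mem_singleton]
      at hrest
    refine ⟨fun h => hrest.1.1.2.2 h hi, fun h => hrest.1.2.2 (Or.inr hi) h,
      fun h => hrest.2.2 (Or.inl (Or.inr hi)) h⟩
  obtain ⟨gs₁, sub₁, len₁, sem₁, time₁, timeG₁, timeP₁, av₁⟩ := b.exists_gates hbnd hbav
  rw [hbE] at len₁ sem₁
  have frame₁ : ∀ i ∉ b.qubits, ∀ g ∈ gs₁, i ∉ g.qubits := fun i hi g hg hi' =>
    hi (sub₁ g hg i hi')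
  have nzs : ∀ i ∈ zs, i ∉ b.qubits := fun i hi hi' => (hdisj i hi').1 hi
  have nE₂ : ∀ i ∈ flat E₂, i ∉ b.qubits := fun i hi hi' => (hdisj i hi').2.1 hi
  have na : a ∉ b.qubits := fun hi' => (hdisj a hi').2.2 rfl
  have τa : runTime gs₁ τ a = 0 := by rw [runTime_apply_of_notMem (frame₁ a na), ha]
  -- The remaining entries are evaluated using the slope qubits below the root as work qubits; these
  -- are only promised to be clean when the root slope is `1`.
  obtain ⟨gs₂, r, hr, sub₂, len₂, sem₂, time₂, timer₂⟩ : ∃ (gs₂ : List (Gate q)) (r : q),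
      r ∈ zs ++ b.labels.tail ++ flat E₂ ++ [a] ∧
      (∀ g ∈ gs₂, ∀ i ∈ g.qubits, i ∈ zs ++ b.labels.tail ++ flat E₂ ++ [a]) ∧
      gs₂.length ≤ 4 * E₂.length ∧
      (∀ x, (∀ i ∈ zs, x i = false) → (∀ i ∈ b.labels.tail, x i = false) →
        runGates gs₂ x r = evalEntries x E₂ (x a)) ∧
      (∀ i, runTime gs₂ (runTime gs₁ τ) i ≤
        max (runTime gs₁ τ i) (T + 4 * h + 9 * m + 12)) ∧
      runTime gs₂ (runTime gs₁ τ) r ≤ T + 4 * h + 9 * m + 12 := by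
    cases zs with
    | nil =>
      -- Without fresh qubits the capacity is exactly one block.
      have h0 : E₂ = [] := List.eq_nil_of_length_eq_zero (by
        simp only [List.length_nil] at hlen
        omega)
      exact ⟨[], a, by simp, by simp, by simp, fun x _ _ => by rw [h0]; rfl, by simp,
        by simp [τa]⟩
    | cons z zs =>
      rw [List.length_cons] at hm hlen
      have hlist : ∀ i, i ∈ zs ++ (b.labels.setRoot z).toList ++ flat E₂ ++ [a] ↔
          i ∈ z :: zs ++ b.labels.tail ++ flat E₂ ++ [a] := by
        intro i
        simp only [PTree.toList_setRoot, List.mem_append, List.mem_cons]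
        tauto
      -- The next tree is one level higher and starts `4` time units later, so its end moves by `8`;
      -- the final combining gate adds `1`, hence `9` per fresh qubit.
      obtain ⟨gs₂, r, hr, sub₂, len₂, sem₂, time₂, timer₂⟩ := ih zs.length (by omega) zs
        (b.labels.setRoot z) E₂ (τ := runTime gs₁ τ) (T := T + 4) (h := h + 1) (by
          have h1 : (z :: zs ++ b.labels.tail ++ flat E₂ ++ [a]).Nodup := by
            have h3 : b.labels.tail.Sublist b.labels.toList := by
              rw [PTree.toList_eq]
              exact List.sublist_cons_self _ _
            refine hrest.sublist ?_
            simp only [List.append_assoc]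
            exact List.Sublist.append_left
              (List.Sublist.append_right (h3.trans b.labels_sublist) _) _
          have h4 : (zs ++ (b.labels.setRoot z).toList ++ flat E₂ ++ [a]).Perm
              (z :: zs ++ b.labels.tail ++ flat E₂ ++ [a]) := by
            rw [PTree.toList_setRoot]
            exact ((List.perm_middle).append_right _).append_right _
          exact h4.nodup_iff.2 h1)
        (by
          rw [PTree.leaves_setRoot, BTree.leaves_labels, hbE, hlen₁, hlen₂]
          by_cases hle : E.length ≤ 2 * t.leaves
          · rw [Nat.sub_eq_zero_of_le hle]
            exact Nat.zero_le _
          · rw [min_eq_left (by omega)]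
            -- The capacity is a geometric sum: this block takes `2 * t.leaves` entries and the
            -- doubled work tree accounts for the rest.
            have h5 : 2 * t.leaves * (2 ^ (zs.length + 1 + 1) - 1) =
                2 * (2 * t.leaves) * (2 ^ (zs.length + 1) - 1) + 2 * t.leaves := by
              obtain ⟨w, hw⟩ : ∃ w, 2 ^ (zs.length + 1) = w + 1 :=
                ⟨2 ^ (zs.length + 1) - 1, by have := Nat.one_le_two_pow (n := zs.length + 1); omega⟩
              rw [pow_succ, hw, Nat.add_sub_cancel, show (w + 1) * 2 - 1 = 2 * w + 1 by omega]
              ring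
            omega)
        (av₁.setRoot (by
          rw [runTime_apply_of_notMem (frame₁ z (nzs z (by simp))), hzs z (by simp)]))
        (fun i hi => by
          rw [runTime_apply_of_notMem (frame₁ i (nzs i (by simp [hi]))), hzs i (by simp [hi])])
        (fun i hi => by
          rw [runTime_apply_of_notMem (frame₁ i (nE₂ i hi)), hE i (by simp [hi])])
        τa rfl
      refine ⟨gs₂, r, (hlist r).1 hr, fun g hg i hi => (hlist i).1 (sub₂ g hg i hi), len₂,
        fun x hx hx' => sem₂ x (fun i hi => hx i (by simp [hi])) fun i hi => ?_, fun i => ?_, ?_⟩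
      · rw [PTree.toList_setRoot, List.mem_cons] at hi
        rcases hi with rfl | hi
        · exact hx i (by simp)
        · exact hx' i hi
      · have := time₂ i
        omega
      · omega
  have hsub : ∀ i, i ∈ zs ++ b.labels.tail ++ flat E₂ ++ [a] → i ≠ b.rootG ∧ i ≠ b.rootP := by
    intro i hi
    simp only [List.mem_append, List.mem_singleton] at hi
    rcases hi with ((hi | hi) | hi) | rfl
    · exact ⟨fun h => nzs i hi (h ▸ b.rootG_mem), fun h => nzs i hi (h ▸ b.rootP_mem)⟩
    · exact ⟨fun h => b.rootG_notMem_tail hbnd (h ▸ hi),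
        fun h => b.rootP_notMem_tail hbnd (h ▸ hi)⟩
    · exact ⟨fun h => nE₂ i hi (h ▸ b.rootG_mem), fun h => nE₂ i hi (h ▸ b.rootP_mem)⟩
    · exact ⟨fun h => na (h ▸ b.rootG_mem), fun h => na (h ▸ b.rootP_mem)⟩
  have frameG : ∀ g ∈ gs₂, b.rootG ∉ g.qubits := fun g hg hi => (hsub _ (sub₂ g hg _ hi)).1 rfl
  have frameP : ∀ g ∈ gs₂, b.rootP ∉ g.qubits := fun g hg hi => (hsub _ (sub₂ g hg _ hi)).2 rfl
  -- Combines the block `(g, p)` with the value `v` of the rest to `g ⊕ p v`.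
  obtain ⟨g, hg⟩ : ∃ g : Gate q, g = .CCX b.rootP r b.rootG (hsub r hr).2.symm
    (b.rootG_ne_rootP hbnd).symm (hsub r hr).1 := ⟨_, rfl⟩
  have hgq : ∀ i ∈ g.qubits, i = b.rootP ∨ i = r ∨ i = b.rootG := by simp [hg, Gate.qubits]
  have hbmem : ∀ i, i ∈ b.qubits → i ∈ zs ++ t.toList ++ (flat E₁ ++ flat E₂) ++ [a] := by
    intro i hi
    have := hmem i hi
    simp only [List.mem_append]
    tauto
  have hsmem : ∀ i, i ∈ zs ++ b.labels.tail ++ flat E₂ ++ [a] →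
      i ∈ zs ++ t.toList ++ (flat E₁ ++ flat E₂) ++ [a] := by
    intro i hi
    have := fun hi => hbmem i (b.tail_subset hi)
    simp only [List.mem_append] at hi this ⊢
    tauto
  have htime : runTime (gs₁ ++ gs₂ ++ [g]) τ = g.time (runTime gs₂ (runTime gs₁ τ)) := by
    rw [runTime_append, runTime_append]
    rfl
  have hG₂ : runTime gs₂ (runTime gs₁ τ) b.rootG ≤ T + 4 * (h + 1) := by
    rw [runTime_apply_of_notMem frameG]
    exact timeG₁
  have hP₂ : runTime gs₂ (runTime gs₁ τ) b.rootP ≤ T + 4 * (h + 1) := by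
    rw [runTime_apply_of_notMem frameP]
    exact timeP₁
  have hgt : ∀ i, g.time (runTime gs₂ (runTime gs₁ τ)) i ≤
      max (runTime gs₂ (runTime gs₁ τ) i) (T + 4 * h + 9 * m + 13) :=
    g.time_le fun i hi => by
      rcases hgq i hi with rfl | rfl | rfl <;> omega
  refine ⟨gs₁ ++ gs₂ ++ [g], b.rootG, ?_, ?_, ?_, fun x hx hx' => ?_, fun i => ?_, ?_⟩
  · rw [hE12, flat_append]
    exact hbmem _ b.rootG_mem
  · rw [hE12, flat_append]
    intro g' hg' i hi
    rw [List.mem_append, List.mem_append, List.mem_singleton] at hg'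
    rcases hg' with (hg' | hg') | rfl
    · exact hbmem i (sub₁ g' hg' i hi)
    · exact hsmem i (sub₂ g' hg' i hi)
    · rcases hgq i hi with rfl | rfl | rfl
      · exact hbmem _ b.rootP_mem
      · exact hsmem _ hr
      · exact hbmem _ b.rootG_mem
  · simp only [List.length_append, List.length_singleton]
    omega
  · obtain ⟨ev, cl⟩ := sem₁ x fun i hi => hx' i (hbi.subset hi)
    rw [runGates_append, runGates_append]
    set x₁ := runGates gs₁ x with hx₁
    have hact : runGates [g] (runGates gs₂ x₁) b.rootG =
        xor (x₁ b.rootG) (x₁ b.rootP && runGates gs₂ x₁ r) := by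
      rw [runGates_cons, runGates_nil, hg, Gate.act, Function.update_self,
        runGates_apply_of_notMem frameG, runGates_apply_of_notMem frameP]
    rw [hact, hE12, evalEntries_append, ev]
    -- Slope `0`: the value in `r` may be wrong, but the gate ignores it. Slope `1`: the recycled
    -- qubits are clean and the value is right.
    cases hp : x₁ b.rootP with
    | false => rfl
    | true =>
      have h₁ : ∀ i ∉ b.qubits, x₁ i = x i := fun i hi => runGates_apply_of_notMem (frame₁ i hi) x
      rw [sem₂ x₁ (fun i hi => by rw [h₁ i (nzs i hi), hx i hi]) (cl hp), h₁ a na,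
        evalEntries_congr fun i hi => h₁ i (nE₂ i hi)]
  · rw [htime]
    have h₁ := hgt i
    have h₂ := time₂ i
    have h₃ := time₁ i
    omega
  · rw [htime]
    have := hgt b.rootG
    omega

end Programs

/-! ### Uncomputation, the control, and the final bounds. -/

section Assembly

theorem runGates_update {q : Type} [DecidableEq q] {gs : List (Gate q)} {t : q}
    (h : ∀ g ∈ gs, t ∉ g.qubits) (x : q → Bool) (v : Bool) :
    runGates gs (Function.update x t v) = Function.update (runGates gs x) t v := by
  ext i
  by_cases hi : i = t
  · subst hi
    rw [runGates_apply_of_notMem h, Function.update_self, Function.update_self]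
  · rw [Function.update_of_ne hi]
    exact runGates_congr (s := {t}ᶜ) (fun g hg j hj hjt => h g hg (hjt ▸ hj))
      (fun j hj => Function.update_of_ne hj v x) hi

/-- The flip of `t` passes through the inverse circuit, which does not touch `t`; the rest cancels.
-/
theorem Circuit.op_conj {q : Type} [Fintype q] [DecidableEq q] (c : Circuit q) {a b t : q}
    (hab : a ≠ b) (ha : a ≠ t) (hb : b ≠ t)
    (hca : ∀ g ∈ c.layers.flatten, a ∉ g.qubits) (hct : ∀ g ∈ c.layers.flatten, t ∉ g.qubits) :
    (c.conj (.CCX a b t hab ha hb)).op = basisOp fun x =>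
      Function.update x t (xor (x t) (x a && runGates c.layers.flatten x b)) := by
  rw [Circuit.op_eq_basisOp, Circuit.flatten_conj]
  congr 1
  ext1 x
  change runGates _ x = _
  rw [runGates_append, runGates_append, runGates_cons, runGates_nil, Gate.act,
    runGates_apply_of_notMem hct, runGates_apply_of_notMem hca,
    runGates_update (fun g hg => hct g (List.mem_reverse.1 hg)), runGates_reverse]

/-- If a circuit that touches neither the control nor the qubit `t₀` computes a bit `φ` in the
qubit `b`, then copying this bit to `t₀` under the control and undoing the circuit gives a
controlled strong promise gate. -/
theorem Circuit.isControlledStrongPromiseGate_conj {p t : Type} [Fintype p] [DecidableEq p]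
    [Fintype t] [DecidableEq t] (c : Circuit (Unit ⊕ (p ⊕ t))) {b : Unit ⊕ (p ⊕ t)} {t₀ : t}
    (hab : Sum.inl () ≠ b) (hb : b ≠ Sum.inr (Sum.inr t₀))
    (hsub : ∀ g ∈ c.layers.flatten, ∀ i ∈ g.qubits,
      i ≠ Sum.inl () ∧ i ≠ Sum.inr (Sum.inr t₀))
    (φ : (t → Bool) → Bool)
    (hφ : ∀ x : Unit ⊕ (p ⊕ t) → Bool, (∀ i, x (Sum.inr (Sum.inl i)) = false) →
      runGates c.layers.flatten x b = φ fun i => x (Sum.inr (Sum.inr i))) :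
    IsControlledStrongPromiseGate
      (basisOp fun y : t → Bool => Function.update y t₀ (xor (y t₀) (φ y)))
      (c.conj (.CCX (Sum.inl ()) b (Sum.inr (Sum.inr t₀)) hab (by simp) hb)).op := by
  -- The bit computed for an arbitrary promise string; the control value is irrelevant and set to
  -- `0`.
  set ψ : (p → Bool) → (t → Bool) → Bool := fun j y =>
    runGates c.layers.flatten (Sum.elim (fun _ => false) (Sum.elim j y)) b with hψ
  have hcongr : ∀ x y : Unit ⊕ (p ⊕ t) → Bool,
      (∀ i, i ≠ Sum.inl () → i ≠ Sum.inr (Sum.inr t₀) → x i = y i) →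
      runGates c.layers.flatten x b = runGates c.layers.flatten y b := fun x y hxy =>
    runGates_congr (s := {i | i ≠ Sum.inl () ∧ i ≠ Sum.inr (Sum.inr t₀)}) hsub
      (fun i hi => hxy i hi.1 hi.2) ⟨hab.symm, hb⟩
  have hψ₀ : (fun y : t → Bool => Function.update y t₀ (xor (y t₀) (φ y))) =
      fun y => Function.update y t₀ (xor (y t₀) (ψ (fun _ => false) y)) := by
    ext1 y
    rw [hψ]
    dsimp only
    rw [hφ _ fun _ => rfl]
    rfl
  rw [Circuit.op_conj c _ _ _ (fun g hg hi => (hsub g hg _ hi).1 rfl)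
    fun g hg hi => (hsub g hg _ hi).2 rfl, hψ₀]
  refine isControlledStrongPromiseGate_basisOp
    (fun j y => Function.update y t₀ (xor (y t₀) (ψ j y))) (fun j => ?_) _ fun x => ?_
  · refine Function.Involutive.injective fun y => ?_
    -- Independence of the flipped bit makes each `W j` an involution.
    have hind : ∀ v, ψ j (Function.update y t₀ v) = ψ j y := by
      intro v
      refine hcongr _ _ fun i _ hi => ?_
      rcases i with i | i | i
      · rfl
      · rfl
      · exact Function.update_of_ne (fun h => hi (by rw [h])) _ _
    change Function.update (Function.update y t₀ _) t₀
      (xor (Function.update y t₀ _ t₀) (ψ j (Function.update y t₀ _))) = y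
    rw [hind, Function.update_self, Function.update_idem]
    simp
  · have hx : runGates c.layers.flatten x b =
        ψ (x ∘ Sum.inr ∘ Sum.inl) (x ∘ Sum.inr ∘ Sum.inr) := by
      refine hcongr _ _ fun i hi _ => ?_
      rcases i with i | i | i
      · exact absurd rfl hi
      · rfl
      · rfl
    rw [hx]
    split_ifs with hc
    · ext i
      rw [hc, Bool.true_and]
      rcases i with i | i | i
      · rfl
      · rfl
      · by_cases hi : i = t₀
        · subst hi
          rw [Function.update_self]
          exact (Function.update_self (f := x ∘ Sum.inr ∘ Sum.inr) ..).symm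
        · rw [Function.update_of_ne fun h => hi (Sum.inr_injective (Sum.inr_injective h))]
          exact (Function.update_of_ne (f := x ∘ Sum.inr ∘ Sum.inr) hi ..).symm
    · simp [hc]

/-- The entries `(x₂ᵢ, x₂ᵢ₋₁)` for `i = j, …, 1`. -/
def carryEntries {q : Type} (f : ℕ → q) : ℕ → List (q × q)
  | 0 => []
  | j + 1 => (f (2 * (j + 1)), f (2 * j + 1)) :: carryEntries f j

theorem length_carryEntries {q : Type} (f : ℕ → q) (j : ℕ) : (carryEntries f j).length = j := by
  induction j with
  | zero => rfl
  | succ j ih => rw [carryEntries, List.length_cons, ih]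

theorem evalEntries_carryEntries {q : Type} (f : ℕ → q) (x : q → Bool) (j : ℕ) :
    evalEntries x (carryEntries f j) (x (f 0)) = carry (fun i => x (f i)) j := by
  induction j with
  | zero => rfl
  | succ j ih => rw [carry, ← ih]; rfl

/-- Shows that the entries and the starting qubit use each of the first `2 j + 1` qubits once. -/
theorem flat_carryEntries {q : Type} (f : ℕ → q) (j : ℕ) :
    flat (carryEntries f j) ++ [f 0] = (List.range (2 * j + 1)).reverse.map f := by
  induction j with
  | zero => rfl
  | succ j ih =>
    rw [carryEntries, flat_cons, List.cons_append, List.cons_append, ih,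
      show 2 * (j + 1) + 1 = 2 * j + 1 + 1 + 1 by ring, List.range_succ (n := 2 * j + 1 + 1),
      List.range_succ (n := 2 * j + 1), List.reverse_append, List.reverse_append]
    rfl

/-- With `s = ⌈√n⌉`, `n ≤ s² ≤ 2 ^ (2 s - 2)`; equality holds at `n = 1`, so the promise register is
just large enough there. -/
theorem log_add_two_le (n : ℕ) (hn : 1 ≤ n) : Nat.log 2 n + 2 ≤ 2 * ⌈Real.sqrt (n : ℝ)⌉₊ := by
  set s := ⌈Real.sqrt (n : ℝ)⌉₊ with hs
  have hsq : n ≤ s ^ 2 := by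
    have h := (Real.sqrt_le_iff.1 (Nat.le_ceil (Real.sqrt (n : ℝ)))).2
    exact_mod_cast h
  have hs1 : 1 ≤ s := by
    by_contra h
    rw [show s = 0 by omega] at hsq
    omega
  have h1 : s ≤ 2 ^ (s - 1) := by
    have := Nat.lt_two_pow_self (n := s - 1)
    omega
  have h2 : n < 2 ^ (2 * s - 1) := by
    calc n ≤ s ^ 2 := hsq
      _ ≤ (2 ^ (s - 1)) ^ 2 := Nat.pow_le_pow_left h1 2
      _ = 2 ^ (2 * s - 2) := by rw [← pow_mul]; congr 1; omega
      _ < 2 ^ (2 * s - 1) := Nat.pow_lt_pow_right one_lt_two (by omega)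
  have := Nat.log_lt_of_lt_pow (by omega) h2
  omega

/-- Uses only `log 2 ≥ 1/2`. -/
theorem natLog_le (n : ℕ) : (Nat.log 2 n : ℝ) ≤ 2 * Real.log n := by
  rcases Nat.eq_zero_or_pos n with rfl | hn
  · simp
  have h1 : ((2 ^ Nat.log 2 n : ℕ) : ℝ) ≤ n := by
    exact_mod_cast Nat.pow_log_le_self 2 hn.ne'
  have h2 := Real.log_le_log (by positivity) h1
  rw [Nat.cast_pow, Real.log_pow] at h2
  have h3 := Real.log_two_gt_d9
  have h4 : (0 : ℝ) ≤ Nat.log 2 n := Nat.cast_nonneg _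
  push_cast at h2
  nlinarith

/-- A controlled strong promise gate for `𝓥₂⁽ᵐ⁺¹⁾`, with explicit bounds. -/
theorem exists_circuit_vOp (m P : ℕ) (hP : Nat.log 2 (m + 1) + 2 ≤ P) :
    ∃ c : Circuit (Unit ⊕ (Fin P ⊕ Fin (2 * (m + 1) + 1))),
      IsControlledStrongPromiseGate (vOp 2 (m + 1)) c.op ∧
      c.gateCount ≤ 8 * m + 3 ∧ c.depth ≤ 18 * Nat.log 2 (m + 1) + 29 := by
  set l := Nat.log 2 (m + 1) with hl
  -- The promise qubits `α 0, …, α (l - 1)` are the fresh roots, `α l` is the initial one-leaf work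
  -- tree, and `α (l + 1)` receives the result. Reduction modulo the register size only makes the
  -- indexing total.
  set α : ℕ → Unit ⊕ (Fin P ⊕ Fin (2 * (m + 1) + 1)) := fun k =>
    Sum.inr (Sum.inl ⟨k % P, Nat.mod_lt _ (by omega)⟩) with hα
  set f : ℕ → Unit ⊕ (Fin P ⊕ Fin (2 * (m + 1) + 1)) := fun k =>
    Sum.inr (Sum.inr ⟨k % (2 * (m + 1) + 1), Nat.mod_lt _ (by omega)⟩) with hf
  have αinj : ∀ i j, i < P → j < P → α i = α j → i = j := by
    intro i j hi hj h
    simpa [hα, Nat.mod_eq_of_lt hi, Nat.mod_eq_of_lt hj] using h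
  have finj : ∀ i j, i < 2 * (m + 1) + 1 → j < 2 * (m + 1) + 1 → f i = f j → i = j := by
    intro i j hi hj h
    simpa [hf, Nat.mod_eq_of_lt hi, Nat.mod_eq_of_lt hj] using h
  have αf : ∀ i j, α i ≠ f j := fun i j h => by simp [hα, hf] at h
  have hlist : (List.range l).map α ++ (PTree.leaf (α l)).toList ++ flat (carryEntries f m) ++
      [f 0] = (List.range (l + 1)).map α ++ (List.range (2 * m + 1)).reverse.map f := by
    rw [List.append_assoc, flat_carryEntries, List.range_succ (n := l), List.map_append]
    rfl
  have hmem : ∀ i, i ∈ (List.range l).map α ++ (PTree.leaf (α l)).toList ++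
      flat (carryEntries f m) ++ [f 0] →
      (∃ k, k ≤ l ∧ i = α k) ∨ ∃ k, k ≤ 2 * m ∧ i = f k := by
    intro i hi
    rw [hlist, List.mem_append, List.mem_map, List.mem_map] at hi
    rcases hi with ⟨k, hk, rfl⟩ | ⟨k, hk, rfl⟩
    · exact Or.inl ⟨k, Nat.lt_succ_iff.1 (List.mem_range.1 hk), rfl⟩
    · exact Or.inr ⟨k, Nat.lt_succ_iff.1 (List.mem_range.1 (List.mem_reverse.1 hk)), rfl⟩
  have hnd : ((List.range l).map α ++ (PTree.leaf (α l)).toList ++ flat (carryEntries f m) ++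
      [f 0]).Nodup := by
    rw [hlist, List.nodup_append']
    refine ⟨List.Nodup.map_on ?_ List.nodup_range,
      List.Nodup.map_on ?_ (List.nodup_reverse.2 List.nodup_range), ?_⟩
    · intro i hi j hj
      rw [List.mem_range] at hi hj
      exact αinj i j (by omega) (by omega)
    · intro i hi j hj
      rw [List.mem_reverse, List.mem_range] at hi hj
      exact finj i j (by omega) (by omega)
    · intro i hi hi'
      obtain ⟨k, -, rfl⟩ := List.mem_map.1 hi
      obtain ⟨k', -, hk'⟩ := List.mem_map.1 hi'
      exact αf _ _ hk'.symm
  -- Ensures that `m` entries fit into the capacity `2 * (2 ^ (l + 1) - 1)`.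
  have hlog : m + 1 < 2 ^ (l + 1) := Nat.lt_pow_succ_log_self one_lt_two _
  obtain ⟨gs, r, hr, sub, len, sem, time, timer⟩ := exists_gates_evalEntries
    ((List.range l).map α) (.leaf (α l)) (carryEntries f m) (f 0) (τ := 0) (T := 0) (h := 0) hnd
    (by
      rw [length_carryEntries, List.length_map, List.length_range, PTree.leaves]
      omega)
    (Nat.zero_le _) (fun _ _ => rfl) (fun _ _ => rfl) rfl
  rw [length_carryEntries] at len
  simp only [List.length_map, List.length_range, Pi.zero_apply] at time timer
  have hne : ∀ i, ((∃ k, k ≤ l ∧ i = α k) ∨ ∃ k, k ≤ 2 * m ∧ i = f k) →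
      i ≠ α (l + 1) ∧ i ≠ f (2 * m + 1) ∧ i ≠ f (2 * m + 2) ∧ i ≠ Sum.inl () := by
    rintro i (⟨k, hk, rfl⟩ | ⟨k, hk, rfl⟩)
    · refine ⟨fun h => ?_, αf _ _, αf _ _, by simp [hα]⟩
      have := αinj _ _ (by omega) (by omega) h
      omega
    · refine ⟨fun h => αf _ _ h.symm, fun h => ?_, fun h => ?_, by simp [hf]⟩
      · have := finj _ _ (by omega) (by omega) h
        omega
      · have := finj _ _ (by omega) (by omega) h
        omega
  have hr' := hne r (hmem r hr)
  have sub' := fun g hg i hi => hne i (hmem i (sub g hg i hi))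
  have hff : f (2 * m + 1) ≠ f (2 * m + 2) := fun h => by
    have := finj _ _ (by omega) (by omega) h
    omega
  have hlast : f (2 * m + 2) = Sum.inr (Sum.inr (Fin.last _)) := by
    simp only [hf, Fin.last]
    congr 3
    exact Nat.mod_eq_of_lt (by omega)
  -- Multiplies the carry by `x₂ₘ₊₁` into a clean qubit, so that the controlled copy needs only one
  -- Toffoli gate.
  obtain ⟨g, hg⟩ : ∃ g : Gate _, g = .CCX (f (2 * m + 1)) r (α (l + 1)) hr'.2.1.symm
    (αf _ _).symm hr'.1 := ⟨_, rfl⟩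
  have hgq : ∀ i ∈ g.qubits, i = f (2 * m + 1) ∨ i = r ∨ i = α (l + 1) := by
    simp [hg, Gate.qubits]
  obtain ⟨c, hdepth, hperm, hrun⟩ := exists_circuit (gs ++ [g]) (9 * l + 14) fun i => by
    rw [runTime_append]
    have h1 := Gate.time_le (g := g) (τ := runTime gs 0) (B := 9 * l + 14)
      (fun i _ => by have := time i; omega) i
    have h2 := time i
    rw [runTime_cons, runTime_nil]
    omega
  have subc : ∀ g' ∈ c.layers.flatten, ∀ i ∈ g'.qubits,
      i ≠ Sum.inl () ∧ i ≠ Sum.inr (Sum.inr (Fin.last _)) := by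
    intro g' hg' i hi
    rw [← hlast]
    rw [hperm.mem_iff, List.mem_append, List.mem_singleton] at hg'
    rcases hg' with hg' | rfl
    · exact ⟨(sub' g' hg' i hi).2.2.2, (sub' g' hg' i hi).2.2.1⟩
    · rcases hgq i hi with rfl | rfl | rfl
      · exact ⟨by simp [hf], hff⟩
      · exact ⟨hr'.2.2.2, hr'.2.2.1⟩
      · exact ⟨by simp [hα], αf _ _⟩
  have key := c.isControlledStrongPromiseGate_conj (b := α (l + 1)) (t₀ := Fin.last _)
    (by simp [hα]) (by simp [hα]) subc
    (fun y => extend y (2 * m + 1) && carry (extend y) m) fun x hx => by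
      have hx' : ∀ k, x (α k) = false := fun k => hx _
      have hfx : ∀ k < 2 * (m + 1) + 1,
          x (f k) = extend (fun i => x (Sum.inr (Sum.inr i))) k := by
        intro k hk
        rw [extend_of_lt _ hk]
        simp only [hf, Nat.mod_eq_of_lt hk]
      rw [hrun, runGates_append, runGates_cons, runGates_nil, hg, Gate.act, Function.update_self,
        sem x (fun i hi => by obtain ⟨k, -, rfl⟩ := List.mem_map.1 hi; exact hx' k)
          (fun i hi => by rw [List.mem_singleton.1 hi]; exact hx' l),
        runGates_apply_of_notMem fun g' hg' hi => (sub' g' hg' _ hi).1 rfl,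
        runGates_apply_of_notMem fun g' hg' hi => (sub' g' hg' _ hi).2.1 rfl,
        hx', Bool.false_xor, hfx _ (by omega), evalEntries_carryEntries,
        carry_congr fun k hk => hfx k (by omega)]
  refine ⟨_, by rw [vOp_two_succ]; exact key, ?_, ?_⟩
  · have hcount : c.gateCount = gs.length + 1 := by
      rw [Circuit.gateCount, hperm.length_eq, List.length_append, List.length_singleton]
    rw [Circuit.gateCount_conj, hcount]
    omega
  · rw [Circuit.depth_conj, hdepth]
    omega

end Assembly

end PromiseGate

theorem mainTheorem12 :
    ∃ C : ℝ, 0 < C ∧ ∀ n : ℕ, 1 ≤ n →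
      ∃ c : PromiseGate.Circuit (Unit ⊕ (Fin (2 * ⌈Real.sqrt (n : ℝ)⌉₊) ⊕ Fin (2 * n + 1))),
        PromiseGate.IsControlledStrongPromiseGate (PromiseGate.vOp 2 n) c.op ∧
        (c.gateCount : ℝ) ≤ C * (n : ℝ) ∧
        (2 ≤ n → (c.depth : ℝ) ≤ C * Real.log (n : ℝ)) := by
  -- For `n ≥ 2`, `L = Nat.log 2 n ≥ 1` gives `18 L + 29 ≤ 47 L`, and `L ≤ 2 log n` doubles the
  -- constant.
  refine ⟨94, by norm_num, fun n hn => ?_⟩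
  have hP := PromiseGate.log_add_two_le n hn
  obtain ⟨m, rfl⟩ : ∃ m, n = m + 1 := ⟨n - 1, by omega⟩
  obtain ⟨c, hc, hcount, hdepth⟩ := PromiseGate.exists_circuit_vOp m _ hP
  refine ⟨c, hc, ?_, fun h2 => ?_⟩
  · have h : (c.gateCount : ℝ) ≤ 8 * m + 3 := by exact_mod_cast hcount
    push_cast
    linarith [(Nat.cast_nonneg m : (0 : ℝ) ≤ m)]
  · have h : (c.depth : ℝ) ≤ 18 * Nat.log 2 (m + 1) + 29 := by exact_mod_cast hdepth
    have h1 : (1 : ℝ) ≤ Nat.log 2 (m + 1) := by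
      exact_mod_cast Nat.log_pos one_lt_two h2
    have h3 := PromiseGate.natLog_le (m + 1)
    linarith
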